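/- Let $D\ge 1$ and $n\ge 0$ be integers, and write $x^{2s}=(\sum_\mu x^\mu x^\mu)^s$ for $x\in\mathbb R^D$, $s\in\mathbb C$, and $s'=D/2-s$. For $v\in\mathbb R^D$ let $v^{\mu_1\ldots\mu_n}$ be the symmetric traceless part of $v^{\mu_1}\cdots v^{\mu_n}$ (its image under the orthogonal projector onto symmetric traceless tensors of rank $n$). For $\alpha,\beta\in\mathbb C$ and $y\in\mathbb R^D$ define the conformal triangle $$\Psi_{\alpha,\beta,y}^{\mu_1\ldots\mu_n}(x_1,x_2)=\frac{\Bigl(\frac{y-x_1}{(y-x_1)^2}-\frac{y-x_2}{(y-x_2)^2}\Bigr)^{\mu_1\ldots\mu_n}}{(x_1-x_2)^{2\alpha}\,(y-x_1)^{2\alpha'}\,(y-x_2)^{2(\alpha+\beta)'}} .$$ Let $Q^{(\beta)}_{12}=a(\beta)^{-1}\,P_{12}\,p_1^{-2\beta}\,q_{12}^{-2\beta}$, acting on functions $f(x_1,x_2)$, where $a(\beta)=2^{-2\beta}\pi^{-D/2}\,\Gamma(\beta')/\Gamma(\beta)$, $q_{12}^{-2\beta}$ is multiplication by $(x_1-x_2)^{-2\beta}$,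 $p_1^{-2\beta}$ is the integral operator $f\mapsto a(\beta)\int_{\mathbb R^D} d^Dz\, f(z,x_2)\,(x_1-z)^{-2\beta'}$, and $(P_{12}f)(x_1,x_2)=f(x_2,x_1)$. Put $$\tau(\alpha,\beta,n)=(-1)^n\,\frac{\pi^{D/2}\,\Gamma(\beta)\,\Gamma(\alpha)\,\Gamma(\alpha'-\beta+n)}{\Gamma(\beta')\,\Gamma(\alpha'+n)\,\Gamma(\alpha+\beta)},$$ where $1/\Gamma$ is the entire function. Then for all pairwise distinct $x_1,x_2,y\in\mathbb R^D$ and all indices $\mu_1,\dots,\mu_n$: (i) if $\operatorname{Re}\beta>0$, $\operatorname{Re}\alpha>n/2$ and $\operatorname{Re}(\alpha+\beta)<(D+n)/2$, the integral defining $(Q^{(\beta)}_{12}\Psi_{\alpha,\beta,y}^{\mu_1\ldots\mu_n})(x_1,x_2)$ converges absolutely and $$Q^{(\beta)}_{12}\,\Psi_{\alpha,\beta,y}^{\mu_1\ldots\mu_n}(x_1,x_2)=\tau(\alpha,\beta,n)\,\Psi_{\alpha,\beta,y}^{\mu_1\ldots\mu_n}(x_1,x_2);$$ (ii) for arbitrary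 $(\alpha,\beta)\in\mathbb C^2$ such that none of $\beta$, $\alpha$, $\alpha'-\beta+n$ is a pole of $\Gamma$, the same equation holds when its left-hand side is understood by analytic continuation in the parameters: as a function of $(\alpha,\beta)$ the left-hand side has an analytic continuation from the region in (i) to the connected open set of all such $(\alpha,\beta)$, and every such continuation equals $\tau(\alpha,\beta,n)\,\Psi_{\alpha,\beta,y}^{\mu_1\ldots\mu_n}(x_1,x_2)$ there; (iii) if $D\ge 2$, the tensor $\Psi_{\alpha,\beta,y}^{\mu_1\ldots\mu_n}(x_1,x_2)$ is nonzero for all $\alpha,\beta\in\mathbb C$. -/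

import Mathlib

open MeasureTheory Set

noncomputable section

/-- The Euclidean space `ℝ^D`. -/
abbrev E (D : ℕ) : Type := EuclideanSpace ℝ (Fin D)

/-- Real tensors `T^{μ₁…μₙ}` of rank `n` over `ℝ^D`, with the Euclidean inner product
`⟨S, T⟩ = ∑ S^{μ₁…μₙ} T^{μ₁…μₙ}`. -/
abbrev Tens (D n : ℕ) : Type := EuclideanSpace ℝ (Fin n → Fin D)

/-- The space of symmetric traceless tensors of rank `n`: invariant under all permutations of the
indices, and with vanishing contraction of every pair of distinct indices. -/
def symTraceless (D n : ℕ) : Submodule ℝ (Tens D n) where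
  carrier := {T | (∀ (σ : Equiv.Perm (Fin n)) (ρ : Fin n → Fin D), T (ρ ∘ σ) = T ρ) ∧
    ∀ i j : Fin n, i ≠ j → ∀ ρ : Fin n → Fin D,
      ∑ a : Fin D, T (Function.update (Function.update ρ i a) j a) = 0}
  add_mem' := by
    rintro S T ⟨hS, hS'⟩ ⟨hT, hT'⟩
    refine ⟨fun σ ρ => ?_, fun i j hij ρ => ?_⟩
    · simp [hS, hT]
    · simp [Finset.sum_add_distrib, hS' i j hij ρ, hT' i j hij ρ]
  zero_mem' := by simp
  smul_mem' := by
    rintro c T ⟨hT, hT'⟩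
    refine ⟨fun σ ρ => ?_, fun i j hij ρ => ?_⟩
    · simp [hT]
    · simp [← Finset.mul_sum, hT' i j hij ρ]

/-- The tensor power `v^{μ₁} ⋯ v^{μₙ}`. -/
def tensorPow {D : ℕ} (n : ℕ) (v : E D) : Tens D n :=
  WithLp.toLp 2 fun μ => ∏ i, v (μ i)

/-- `v^{μ₁…μₙ}`: the symmetric traceless part of `v^{μ₁} ⋯ v^{μₙ}`, that is, its image under the
(orthogonal) projector onto the symmetric traceless tensors. -/
def tracelessPow {D : ℕ} (n : ℕ) (v : E D) : Tens D n :=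
  (symTraceless D n).starProjection (tensorPow n v)

/-- `x^{2s} = (∑ x^μ x^μ)^s` for a complex exponent `s`. -/
def sqPow {D : ℕ} (x : E D) (s : ℂ) : ℂ := ((‖x‖ ^ 2 : ℝ) : ℂ) ^ s

/-- The conformal inversion `x / x²`. -/
def inversion {D : ℕ} (x : E D) : E D := (‖x‖ ^ 2)⁻¹ • x

/-- The dual index `s' = D/2 - s`. -/
def dualIndex (D : ℕ) (s : ℂ) : ℂ := (D : ℂ) / 2 - s

/-- The conformal triangle `Ψ_{α,β,y}^{μ₁…μₙ}(x₁, x₂)`. -/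
def conformalTriangle {D n : ℕ} (α β : ℂ) (y : E D) (μ : Fin n → Fin D) (x₁ x₂ : E D) : ℂ :=
  ((tracelessPow n (inversion (y - x₁) - inversion (y - x₂)) μ : ℝ) : ℂ) /
    (sqPow (x₁ - x₂) α * sqPow (y - x₁) (dualIndex D α) * sqPow (y - x₂) (dualIndex D (α + β)))

/-- `a(β) = 2^{-2β} π^{-D/2} Γ(β') / Γ(β)`, the constant in the Fourier transform of `k^{-2β}`. -/
def aCoeff (D : ℕ) (β : ℂ) : ℂ :=
  1 / ((2 : ℂ) ^ (2 * β) * (Real.pi : ℂ) ^ ((D : ℂ) / 2)) *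
    (Complex.Gamma (dualIndex D β) / Complex.Gamma β)

/-- The multiplication operator `(q₁₂)^{-2β}`, where `q₁₂ = q₁ - q₂`. -/
def q12NegPow {D : ℕ} (β : ℂ) (f : E D → E D → ℂ) : E D → E D → ℂ :=
  fun x₁ x₂ => f x₁ x₂ / sqPow (x₁ - x₂) β

/-- The integrand of the integral operator `(p₁)^{-2β}` at `(x₁, x₂)`. -/
def p1Integrand {D : ℕ} (β : ℂ) (f : E D → E D → ℂ) (x₁ x₂ : E D) : E D → ℂ :=
  fun z => f z x₂ / sqPow (x₁ - z) (dualIndex D β)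

/-- The operator `(p₁)^{-2β}`: the integral operator in the first variable with kernel
`⟨x|p^{-2β}|z⟩ = a(β) / (x - z)^{2β'}`. -/
def p1NegPow {D : ℕ} (β : ℂ) (f : E D → E D → ℂ) : E D → E D → ℂ :=
  fun x₁ x₂ => aCoeff D β * ∫ z, p1Integrand β f x₁ x₂ z

/-- The permutation operator `P₁₂`. -/
def swap12 {D : ℕ} (f : E D → E D → ℂ) : E D → E D → ℂ := fun x₁ x₂ => f x₂ x₁

/-- The graph-building operator `Q₁₂^{(β)} = a(β)⁻¹ P₁₂ (p₁)^{-2β} (q₁₂)^{-2β}`. -/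
def graphBuilding {D : ℕ} (β : ℂ) (f : E D → E D → ℂ) : E D → E D → ℂ :=
  fun x₁ x₂ => (aCoeff D β)⁻¹ * swap12 (p1NegPow β (q12NegPow β f)) x₁ x₂

/-- Absolute convergence of the integral that defines `(Q₁₂^{(β)} f)(x₁, x₂)`. -/
def GraphBuildingConverges {D : ℕ} (β : ℂ) (f : E D → E D → ℂ) (x₁ x₂ : E D) : Prop :=
  Integrable (p1Integrand β (q12NegPow β f) x₂ x₁)

/-- The eigenvalue `τ(α, β, n)`. -/
def eigenvalue (D n : ℕ) (α β : ℂ) : ℂ :=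
  (-1) ^ n * ((Real.pi : ℂ) ^ ((D : ℂ) / 2) * Complex.Gamma β * Complex.Gamma α *
      Complex.Gamma (dualIndex D α - β + n)) /
    (Complex.Gamma (dualIndex D β) * Complex.Gamma (dualIndex D α + n) * Complex.Gamma (α + β))

/-- The parameters `(α, β)` with `Re β > 0`, `Re α > n/2` and `Re (α + β) < (D + n)/2`. -/
def convergenceDomain (D n : ℕ) : Set (ℂ × ℂ) :=
  {p | 0 < p.2.re ∧ (n : ℝ) / 2 < p.1.re ∧ p.1.re + p.2.re < ((D : ℝ) + n) / 2}

/-- The parameters `(α, β)` at which none of the numbers `β`, `α`, `α' - β + n` is a pole of `Γ`. -/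
def regularDomain (D n : ℕ) : Set (ℂ × ℂ) :=
  {p | ∀ k : ℕ, p.2 ≠ -(k : ℂ) ∧ p.1 ≠ -(k : ℂ) ∧ dualIndex D p.1 - p.2 + n ≠ -(k : ℂ)}

/-- `G` is an analytic continuation of `F`, given on the open set `Ω`, to the domain `U`. -/
def IsAnalyticContinuation (F : ℂ × ℂ → ℂ) (Ω U : Set (ℂ × ℂ)) (G : ℂ × ℂ → ℂ) : Prop :=
  IsOpen Ω ∧ Ω.Nonempty ∧ Ω ⊆ U ∧ IsOpen U ∧ IsConnected U ∧ AnalyticOnNhd ℂ G U ∧ EqOn G F Ω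

end

noncomputable section

/-! Inversion about `y` turns the conformal triangle into a translation-covariant kernel. With `x_i
= y - inversion u_i`, the difference of inversions in the numerator is `u₁ - u₂`, and up to powers
of `u₁²` and `u₂²` the triangle is `T(u₁ - u₂) / (u₁ - u₂)^{2α}`, where `T` is the form of a
symmetric traceless tensor (`conformalTriangle_eq`). In the integral for `Q₁₂`, the powers of the
inverted integration variable cancel exactly against the Jacobian (`p1Integrand_conformalTriangle`).
What remains is the convolution of `T(w) / w^{2(α+β)}` with `1 / w^{2β'}`, evaluated at `u₂ - u₁`;
the sign `(-1)^n` is the parity of `T`.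

The convolution is computed in `integral_star`. Schwinger parameters `s`, `t` replace both
denominators by Gaussians. Tracelessness makes `T` satisfy a Gaussian mean value property
(`integral_tensorForm_add_mul_exp`), so the integral over `w` returns `T(v)` times `(s / (s + t))^n`
and elementary factors. Putting `t = s x`, the integral over `s` is a gamma integral and that over
`x` a beta integral, which gives the quotient of gamma functions.

For the continuation, `τ Ψ` is itself analytic on the regular domain, so only connectedness of that
domain and the identity theorem are needed. For nonvanishing, `v^{⊗n}` is paired with the real part
of the `n`-th power of a null vector `v + i f`. -/

/-! ### Schwinger parametrization and the beta integral -/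

theorem ofReal_one_div_cpow {r : ℝ} (hr : 0 < r) (a : ℂ) :
    (1 / (r : ℂ)) ^ a = ((r : ℂ) ^ a)⁻¹ := by
  rw [one_div, Complex.inv_cpow]
  rw [Complex.arg_ofReal_of_nonneg hr.le]
  exact Real.pi_pos.ne

theorem integrableOn_cpow_mul_exp_neg_mul {a : ℂ} (ha : 0 < a.re) {r : ℝ} (hr : 0 < r) :
    IntegrableOn (fun t : ℝ => (t : ℂ) ^ (a - 1) * Complex.exp (-(r * t))) (Ioi 0) := by
  -- The Bochner integral of a nonintegrable function is `0` by convention, so the nonzero gamma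
  -- value already proves integrability.
  refine Integrable.of_integral_ne_zero ?_
  rw [Complex.integral_cpow_mul_exp_neg_mul_Ioi ha hr, ofReal_one_div_cpow hr]
  refine mul_ne_zero (inv_ne_zero ?_) (Complex.Gamma_ne_zero_of_re_pos ha)
  rw [Ne, Complex.cpow_eq_zero_iff]
  exact fun h => hr.ne' (by exact_mod_cast h.1)

theorem integral_norm_cpow_mul_exp_neg_mul {a : ℂ} (ha : 0 < a.re) {r : ℝ} (hr : 0 < r) :
    ∫ t in Ioi (0 : ℝ), ‖(t : ℂ) ^ (a - 1) * Complex.exp (-(r * t))‖ =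
      Real.Gamma a.re * ‖((r : ℂ) ^ a)⁻¹‖ := by
  have h := Real.integral_rpow_mul_exp_neg_mul_Ioi ha hr
  rw [norm_inv, Complex.norm_cpow_eq_rpow_re_of_pos hr, mul_comm, ← Real.inv_rpow hr.le,
    ← one_div, ← h]
  refine setIntegral_congr_fun measurableSet_Ioi fun t ht => ?_
  rw [norm_mul, Complex.norm_cpow_eq_rpow_re_of_pos ht, Complex.norm_exp]
  simp

section Schwinger

variable {X : Type*} [MeasurableSpace X] {μ : Measure X} {H : X → ℂ} {N : X → ℝ} {a : ℂ}

/-- The function of `(x, t)` obtained from `H / N ^ a` by introducing a Schwinger parameter `t`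
is integrable. -/
theorem integrable_schwinger (hH : Measurable H) (hN : Measurable N)
    (hpos : ∀ᵐ x ∂μ, 0 < N x) (ha : 0 < a.re)
    (hint : Integrable (fun x => H x / (N x : ℂ) ^ a) μ) :
    Integrable (fun p : X × ℝ => H p.1 * ((p.2 : ℂ) ^ (a - 1) * Complex.exp (-(N p.1 * p.2))))
      (μ.prod (volume.restrict (Ioi 0))) := by
  rw [integrable_prod_iff (by fun_prop)]
  constructor
  · filter_upwards [hpos] with x hx
    exact (integrableOn_cpow_mul_exp_neg_mul ha hx).const_mul _
  · refine (hint.norm.const_mul (Real.Gamma a.re)).congr ?_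
    filter_upwards [hpos] with x hx
    simp only [norm_mul (H x), integral_const_mul]
    rw [integral_norm_cpow_mul_exp_neg_mul ha hx, div_eq_mul_inv, norm_mul]
    ring

/-- Schwinger parametrization of an integral. -/
theorem Gamma_mul_integral_div_cpow [SFinite μ] (hH : Measurable H) (hN : Measurable N)
    (hpos : ∀ᵐ x ∂μ, 0 < N x) (ha : 0 < a.re)
    (hint : Integrable (fun x => H x / (N x : ℂ) ^ a) μ) :
    Complex.Gamma a * ∫ x, H x / (N x : ℂ) ^ a ∂μ =
      ∫ t in Ioi (0 : ℝ), (t : ℂ) ^ (a - 1) * ∫ x, H x * Complex.exp (-(N x * t)) ∂μ := by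
  have hF := integrable_schwinger hH hN hpos ha hint
  have hswap := integral_integral_swap
    (f := fun (x : X) (t : ℝ) => H x * ((t : ℂ) ^ (a - 1) * Complex.exp (-(N x * t)))) hF
  rw [← integral_const_mul]
  refine Eq.trans (integral_congr_ae ?_) (hswap.trans ?_)
  · filter_upwards [hpos] with x hx
    rw [integral_const_mul, Complex.integral_cpow_mul_exp_neg_mul_Ioi ha hx,
      ofReal_one_div_cpow hx]
    ring
  · refine integral_congr_ae (Filter.Eventually.of_forall fun t => ?_)
    simp only
    rw [← integral_const_mul]
    congr 1 with x
    ring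

/-- Almost every section of an integrable function is integrable, and the factor `t ^ (a - 1)` can
be divided out. This permits a second Schwinger parameter once the first is fixed. -/
theorem ae_integrable_mul_exp [SFinite μ] (hH : Measurable H) (hN : Measurable N)
    (hpos : ∀ᵐ x ∂μ, 0 < N x) (ha : 0 < a.re)
    (hint : Integrable (fun x => H x / (N x : ℂ) ^ a) μ) :
    ∀ᵐ t : ℝ ∂(volume.restrict (Ioi 0)),
      Integrable (fun x => H x * Complex.exp (-(N x * t))) μ := by
  filter_upwards [(integrable_schwinger hH hN hpos ha hint).prod_left_ae,
    ae_restrict_mem measurableSet_Ioi] with t ht ht0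
  have h0 : (t : ℂ) ^ (a - 1) ≠ 0 := by
    rw [Ne, Complex.cpow_eq_zero_iff]
    exact fun h => (show (0 : ℝ) < t from ht0).ne' (by exact_mod_cast h.1)
  refine (ht.const_mul ((t : ℂ) ^ (a - 1))⁻¹).congr (Filter.Eventually.of_forall fun x => ?_)
  simp only
  field_simp

end Schwinger

/-- The modulus is at most `x ^ (Re q - 1)` on `(0, 1]` and at most `x ^ (-Re p - 1)` beyond `1`. -/
theorem integrableOn_beta {p q : ℂ} (hp : 0 < p.re) (hq : 0 < q.re) :
    IntegrableOn (fun x : ℝ => (x : ℂ) ^ (q - 1) / ((1 + x : ℝ) : ℂ) ^ (p + q)) (Ioi 0) := by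
  have hmeas : Measurable (fun x : ℝ => (x : ℂ) ^ (q - 1) / ((1 + x : ℝ) : ℂ) ^ (p + q)) := by
    fun_prop
  have hnorm : ∀ x : ℝ, 0 < x → ‖(x : ℂ) ^ (q - 1) / ((1 + x : ℝ) : ℂ) ^ (p + q)‖ =
      x ^ (q.re - 1) / (1 + x) ^ (p.re + q.re) := fun x hx => by
    rw [norm_div, Complex.norm_cpow_eq_rpow_re_of_pos hx,
      Complex.norm_cpow_eq_rpow_re_of_pos (by positivity)]
    simp
  rw [← Ioc_union_Ioi_eq_Ioi (zero_le_one' ℝ)]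
  refine IntegrableOn.union ?_ ?_
  · have h : IntegrableOn (fun x : ℝ => x ^ (q.re - 1)) (Ioc 0 1) := by
      rw [← intervalIntegrable_iff_integrableOn_Ioc_of_le zero_le_one]
      exact intervalIntegral.intervalIntegrable_rpow' (by linarith)
    refine h.mono' hmeas.aestronglyMeasurable ?_
    filter_upwards [ae_restrict_mem measurableSet_Ioc] with x hx
    rw [hnorm x hx.1]
    refine div_le_self (by have := hx.1; positivity) ?_
    exact Real.one_le_rpow (by linarith [hx.1]) (by linarith)
  · have h : IntegrableOn (fun x : ℝ => x ^ (-p.re - 1)) (Ioi 1) :=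
      integrableOn_Ioi_rpow_of_lt (by linarith) zero_lt_one
    refine h.mono' hmeas.aestronglyMeasurable ?_
    filter_upwards [ae_restrict_mem measurableSet_Ioi] with x hx
    have hx1 : (1 : ℝ) < x := hx
    have hx0 : 0 < x := by linarith
    rw [hnorm x hx0, show -p.re - 1 = (q.re - 1) - (p.re + q.re) by ring,
      Real.rpow_sub hx0 (q.re - 1)]
    gcongr
    linarith

/-- The beta integral over the half-line. -/
theorem integral_beta {p q : ℂ} (hp : 0 < p.re) (hq : 0 < q.re) :
    Complex.Gamma (p + q) * ∫ x in Ioi (0 : ℝ), (x : ℂ) ^ (q - 1) / ((1 + x : ℝ) : ℂ) ^ (p + q) =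
      Complex.Gamma p * Complex.Gamma q := by
  have hpos : ∀ᵐ x ∂(volume.restrict (Ioi (0 : ℝ))), 0 < 1 + x := by
    filter_upwards [ae_restrict_mem measurableSet_Ioi] with x hx
    linarith [show (0 : ℝ) < x from hx]
  rw [Gamma_mul_integral_div_cpow (by fun_prop) (by fun_prop) hpos
    (by rw [Complex.add_re]; linarith) (integrableOn_beta hp hq)]
  have hin : ∀ t : ℝ, 0 < t → ∫ x in Ioi (0 : ℝ), (x : ℂ) ^ (q - 1) *
      Complex.exp (-(((1 + x : ℝ) : ℂ) * t)) =
      Complex.exp (-t) * (((t : ℂ) ^ q)⁻¹ * Complex.Gamma q) := fun t ht => by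
    rw [← ofReal_one_div_cpow ht, ← Complex.integral_cpow_mul_exp_neg_mul_Ioi hq ht,
      ← integral_const_mul]
    congr 1 with x
    rw [mul_left_comm, ← Complex.exp_add]
    congr 2
    push_cast
    ring
  rw [Complex.Gamma_eq_integral hp, Complex.GammaIntegral, ← integral_mul_const]
  refine setIntegral_congr_fun measurableSet_Ioi fun t ht => ?_
  have ht0 : (t : ℂ) ≠ 0 := by exact_mod_cast (ne_of_gt ht)
  rw [hin t ht, show p + q - 1 = (p - 1) + q by ring, Complex.cpow_add _ _ ht0]
  have : (t : ℂ) ^ q ≠ 0 := by simp [Complex.cpow_eq_zero_iff, ht0]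
  field_simp
  push_cast
  ring

/-! ### Forms of symmetric traceless tensors -/

/-- The homogeneous polynomial `w ↦ T_{μ₁…μₙ} w^{μ₁} ⋯ w^{μₙ}` of a tensor `T`. -/
def tensorForm {D n : ℕ} (T : Tens D n) (w : E D) : ℝ := ∑ ρ, T ρ * ∏ i, w (ρ i)

theorem continuous_tensorForm {D n : ℕ} (T : Tens D n) : Continuous (tensorForm T) := by
  unfold tensorForm
  fun_prop

theorem tensorForm_smul {D n : ℕ} (T : Tens D n) (c : ℝ) (w : E D) :
    tensorForm T (c • w) = c ^ n * tensorForm T w := by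
  simp only [tensorForm, PiLp.smul_apply, smul_eq_mul, Finset.prod_mul_distrib, Finset.prod_const,
    Finset.card_univ, Fintype.card_fin, Finset.mul_sum]
  exact Finset.sum_congr rfl fun ρ _ => by ring

theorem abs_tensorForm_le {D n : ℕ} (T : Tens D n) (w : E D) :
    |tensorForm T w| ≤ (∑ ρ, |T ρ|) * ‖w‖ ^ n := by
  rw [Finset.sum_mul]
  refine (Finset.abs_sum_le_sum_abs _ _).trans (Finset.sum_le_sum fun ρ _ => ?_)
  rw [abs_mul, Finset.abs_prod]
  gcongr
  refine (Finset.prod_le_prod (fun _ _ => abs_nonneg _)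
    (fun i _ => PiLp.norm_apply_le w (ρ i))).trans ?_
  simp

/-- Since `F` ignores the indices at `i` and `j`, summing over their common value contracts `T` to
zero. -/
theorem sum_diagonal_mul_eq_zero {D n : ℕ} {T : Tens D n} (hT : T ∈ symTraceless D n) {i j : Fin n}
    (hij : i ≠ j) {F : (Fin n → Fin D) → ℝ}
    (hF : ∀ ρ a, F (Function.update (Function.update ρ i a) j a) = F ρ) :
    ∑ ρ with ρ i = ρ j, T ρ * F ρ = 0 := by
  rcases isEmpty_or_nonempty (Fin D) with h | ⟨⟨b⟩⟩
  · exact Finset.sum_eq_zero fun ρ _ => h.elim (ρ i)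
  -- A diagonal multi-index is encoded by its common value at `i`, `j` and by the multi-index with
  -- that value reset to an arbitrary reference `b`.
  have key : ∑ ρ with ρ i = ρ j, T ρ * F ρ =
      ∑ p ∈ (Finset.univ.filter fun ρ : Fin n → Fin D => ρ i = b ∧ ρ j = b) ×ˢ Finset.univ,
        T (Function.update (Function.update p.1 i p.2) j p.2) * F p.1 := by
    refine Finset.sum_bij' (fun ρ _ => (Function.update (Function.update ρ i b) j b, ρ i))
      (fun p _ => Function.update (Function.update p.1 i p.2) j p.2) ?_ ?_ ?_ ?_ ?_
    · intro ρ _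
      simp [Function.update_of_ne hij]
    · intro p _
      simp [Function.update_of_ne hij]
    · intro ρ hρ
      ext k
      have : ρ i = ρ j := by simpa using hρ
      rcases eq_or_ne k j with rfl | hkj
      · simp [this]
      · rcases eq_or_ne k i with rfl | hki
        · simp [Function.update_of_ne hij]
        · simp [Function.update_of_ne hkj, Function.update_of_ne hki]
    · rintro ⟨ρ, a⟩ hρ
      have hρ' : ρ i = b ∧ ρ j = b := by simpa using hρ
      refine Prod.ext (funext fun k => ?_) (by simp [Function.update_of_ne hij])
      rcases eq_or_ne k j with rfl | hkj
      · simp [hρ'.2]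
      · rcases eq_or_ne k i with rfl | hki
        · simp [Function.update_of_ne hij, hρ'.1]
        · simp [Function.update_of_ne hkj, Function.update_of_ne hki]
    · intro ρ hρ
      have : ρ i = ρ j := by simpa using hρ
      rw [hF]
      refine congrArg (fun κ => T κ * F ρ) (funext fun k => ?_)
      simp only
      rcases eq_or_ne k j with rfl | hkj
      · simp [this]
      · rcases eq_or_ne k i with rfl | hki
        · simp [Function.update_of_ne hij]
        · simp [Function.update_of_ne hkj, Function.update_of_ne hki]
  rw [key, Finset.sum_product]
  refine Finset.sum_eq_zero fun ρ _ => ?_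
  simp only
  rw [← Finset.sum_mul, hT.2 i j hij ρ, zero_mul]

/-! ### Gaussian integrals and the mean value property -/

section Gaussian

variable {D : ℕ} {σ : ℝ}

theorem integrable_norm_pow_mul_exp [NeZero D] (hσ : 0 < σ) (k : ℕ) :
    Integrable fun u : E D => ‖u‖ ^ k * Real.exp (-σ * ‖u‖ ^ 2) := by
  have : Nontrivial (E D) := by
    have : Nonempty (Fin D) := ⟨0⟩
    infer_instance
  rw [integrable_fun_norm_addHaar volume (f := fun r => r ^ k * Real.exp (-σ * r ^ 2))]
  have h := (integrable_rpow_mul_exp_neg_mul_sq hσ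
    (s := ((Module.finrank ℝ (E D) - 1 + k : ℕ) : ℝ))
    (lt_of_lt_of_le (by norm_num) (Nat.cast_nonneg _))).integrableOn (s := Ioi 0)
  refine h.congr_fun (fun r _ => ?_) measurableSet_Ioi
  simp only [Real.rpow_natCast, smul_eq_mul, pow_add]
  ring

theorem integrable_prod_mul_exp {ι : Type*} [NeZero D] (hσ : 0 < σ) (S : Finset ι) (ρ : ι → Fin D) :
    Integrable fun u : E D => (∏ i ∈ S, u (ρ i)) * Real.exp (-σ * ‖u‖ ^ 2) := by
  refine (integrable_norm_pow_mul_exp hσ S.card).mono' (by fun_prop)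
    (Filter.Eventually.of_forall fun u => ?_)
  rw [norm_mul, Real.norm_of_nonneg (Real.exp_nonneg _), norm_prod]
  gcongr
  refine (Finset.prod_le_prod (fun _ _ => norm_nonneg _)
    (fun i _ => PiLp.norm_apply_le u (ρ i))).trans ?_
  simp

/-- Gaussian integration by parts for monomials. -/
theorem integral_coord_mul_prod_mul_exp {ι : Type*} [DecidableEq ι] [NeZero D] (hσ : 0 < σ)
    (S : Finset ι) (ρ : ι → Fin D) (a : Fin D) :
    ∫ u : E D, u a * (∏ i ∈ S, u (ρ i)) * Real.exp (-σ * ‖u‖ ^ 2) =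
      (2 * σ)⁻¹ * ∑ j ∈ S, if ρ j = a then
        ∫ u : E D, (∏ i ∈ S.erase j, u (ρ i)) * Real.exp (-σ * ‖u‖ ^ 2) else 0 := by
  set f : E D → ℝ := fun u => Real.exp (-σ * ‖u‖ ^ 2) with hf
  set g : E D → ℝ := fun u => ∏ i ∈ S, u (ρ i) with hg
  set v : E D := EuclideanSpace.single a 1 with hv
  have hdf : ∀ u, HasFDerivAt f (Real.exp (-σ * ‖u‖ ^ 2) • (-σ) • (2 • innerSL ℝ u)) u := fun u =>
    ((hasStrictFDerivAt_norm_sq u).hasFDerivAt.const_mul (-σ)).exp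
  have hdfv : ∀ u, fderiv ℝ f u v = -(2 * σ) * (u a * f u) := fun u => by
    rw [(hdf u).fderiv]
    simp [hv, hf, EuclideanSpace.inner_single_right]
    ring
  have hdg : ∀ u, HasFDerivAt g (∑ j ∈ S, (∏ i ∈ S.erase j, u (ρ i)) •
      (EuclideanSpace.proj (ρ j) : E D →L[ℝ] ℝ)) u := fun u =>
    HasFDerivAt.finsetProd fun j _ => (EuclideanSpace.proj (ρ j) : E D →L[ℝ] ℝ).hasFDerivAt
  have hdgv : ∀ u, fderiv ℝ g u v =
      ∑ j ∈ S, if ρ j = a then ∏ i ∈ S.erase j, u (ρ i) else 0 := fun u => by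
    rw [(hdg u).fderiv]
    simp [hv]
  have hint : ∀ j ∈ S, Integrable fun u : E D => if ρ j = a then
      (∏ i ∈ S.erase j, u (ρ i)) * Real.exp (-σ * ‖u‖ ^ 2) else 0 := fun j _ => by
    split_ifs
    · exact integrable_prod_mul_exp hσ _ _
    · exact integrable_zero _ _ _
  have hcoord : Integrable fun u : E D => u a * g u * f u := by
    -- The additional factor `u a` is treated as one more factor of the monomial, indexed by `none`.
    have := integrable_prod_mul_exp hσ S.insertNone (fun o : Option ι => o.elim a ρ)
    simpa [hf, hg, Finset.prod_insertNone] using this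
  have hfg' : ∀ u, f u * fderiv ℝ g u v = ∑ j ∈ S, if ρ j = a then
      (∏ i ∈ S.erase j, u (ρ i)) * Real.exp (-σ * ‖u‖ ^ 2) else 0 := fun u => by
    rw [hdgv, Finset.mul_sum]
    refine Finset.sum_congr rfl fun j _ => ?_
    split_ifs
    · exact mul_comm _ _
    · exact mul_zero _
  have key := integral_mul_fderiv_eq_neg_fderiv_mul_of_integrable (μ := volume) (f := f) (g := g)
    (v := v) ?_ ?_ ?_ (fun u _ => (hdf u).differentiableAt) (fun u _ => (hdg u).differentiableAt)
  · simp only [hfg', hdfv] at key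
    rw [integral_finsetSum _ hint] at key
    have h1 : ∫ u, -(2 * σ) * (u a * f u) * g u = -(2 * σ) * ∫ u, u a * g u * f u := by
      rw [← integral_const_mul]
      congr 1 with u
      ring
    rw [h1] at key
    have h2 : ∀ j, (∫ u : E D, if ρ j = a then
        (∏ i ∈ S.erase j, u (ρ i)) * Real.exp (-σ * ‖u‖ ^ 2) else 0) = if ρ j = a then
        ∫ u : E D, (∏ i ∈ S.erase j, u (ρ i)) * Real.exp (-σ * ‖u‖ ^ 2) else 0 := fun j => by
      split_ifs <;> simp
    simp only [h2] at key
    rw [key, neg_mul, neg_neg, inv_mul_cancel_left₀ (by positivity)]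
  · simp only [hdfv]
    refine (hcoord.const_mul (-(2 * σ))).congr (Filter.Eventually.of_forall fun u => ?_)
    simp only
    ring
  · simp only [hfg']
    exact integrable_finsetSum _ hint
  · refine (integrable_prod_mul_exp hσ S ρ).congr (Filter.Eventually.of_forall fun u => ?_)
    exact mul_comm _ _

/-- The Gaussian mean value property of the form of a traceless tensor. -/
theorem integral_tensorForm_add_mul_exp {n : ℕ} [NeZero D] (hσ : 0 < σ) {T : Tens D n}
    (hT : T ∈ symTraceless D n) (c : E D) :
    ∫ u : E D, tensorForm T (u + c) * Real.exp (-σ * ‖u‖ ^ 2) =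
      (Real.pi / σ) ^ ((D : ℝ) / 2) * tensorForm T c := by
  -- `S` is the set of slots that receive `u` rather than `c`. Only `S = ∅` survives: otherwise
  -- integration by parts in one slot of `S` produces Kronecker deltas between two slots, that is,
  -- traces of `T`.
  have hexp : ∀ u : E D, tensorForm T (u + c) * Real.exp (-σ * ‖u‖ ^ 2) =
      ∑ S : Finset (Fin n), ∑ ρ, (T ρ * ∏ i ∈ Finset.univ \ S, c (ρ i)) *
        ((∏ i ∈ S, u (ρ i)) * Real.exp (-σ * ‖u‖ ^ 2)) := fun u => by
    rw [Finset.sum_comm, tensorForm, Finset.sum_mul]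
    refine Finset.sum_congr rfl fun ρ _ => ?_
    simp only [PiLp.add_apply]
    rw [Finset.prod_add, Finset.mul_sum, Finset.sum_mul, Finset.powerset_univ]
    exact Finset.sum_congr rfl fun S _ => by ring
  simp only [hexp]
  rw [integral_finsetSum _ fun S _ => integrable_finsetSum _ fun ρ _ =>
    (integrable_prod_mul_exp hσ S ρ).const_mul _]
  rw [Finset.sum_eq_single ∅]
  · rw [integral_finsetSum _ fun ρ _ => (integrable_prod_mul_exp hσ _ ρ).const_mul _]
    simp only [integral_const_mul, Finset.prod_empty, one_mul, Finset.sdiff_empty]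
    rw [GaussianFourier.integral_rexp_neg_mul_sq_norm hσ, ← Finset.sum_mul, tensorForm]
    simp [mul_comm]
  · intro S _ hS
    obtain ⟨i, hi⟩ := Finset.nonempty_iff_ne_empty.mpr hS
    rw [integral_finsetSum _ fun ρ _ => (integrable_prod_mul_exp hσ _ ρ).const_mul _]
    simp only [integral_const_mul]
    have h1 : ∀ ρ : Fin n → Fin D, ∫ u : E D, (∏ i ∈ S, u (ρ i)) * Real.exp (-σ * ‖u‖ ^ 2) =
        (2 * σ)⁻¹ * ∑ j ∈ S.erase i, if ρ j = ρ i then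
          ∫ u : E D, (∏ i ∈ (S.erase i).erase j, u (ρ i)) * Real.exp (-σ * ‖u‖ ^ 2) else 0 := by
      intro ρ
      rw [← integral_coord_mul_prod_mul_exp hσ]
      congr 1 with u
      rw [Finset.mul_prod_erase S (fun i => u (ρ i)) hi]
    simp only [h1, Finset.mul_sum]
    rw [Finset.sum_comm]
    refine Finset.sum_eq_zero fun j hj => ?_
    have hji : j ≠ i := Finset.ne_of_mem_erase hj
    have hjS : j ∈ S := Finset.mem_of_mem_erase hj
    have h2 := sum_diagonal_mul_eq_zero hT hji (F := fun ρ => (∏ i ∈ Finset.univ \ S, c (ρ i)) *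
      ((2 * σ)⁻¹ * ∫ u : E D, (∏ i ∈ (S.erase i).erase j, u (ρ i)) * Real.exp (-σ * ‖u‖ ^ 2))) ?_
    · refine Eq.trans ?_ h2
      rw [Finset.sum_filter]
      refine Finset.sum_congr rfl fun ρ _ => ?_
      split_ifs
      · ring
      · rw [mul_zero, mul_zero]
    · intro ρ a
      have hne : ∀ k, k ≠ i → k ≠ j →
          Function.update (Function.update ρ j a) i a k = ρ k := fun k hki hkj => by
        rw [Function.update_of_ne hki, Function.update_of_ne hkj]
      congr 1
      · refine Finset.prod_congr rfl fun k hk => ?_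
        have hk : k ∉ S := by simpa using hk
        rw [hne k (fun h => hk (h ▸ hi)) (fun h => hk (h ▸ hjS))]
      · congr 1
        congr 1 with u
        congr 1
        refine Finset.prod_congr rfl fun k hk => ?_
        rw [hne k (Finset.ne_of_mem_erase (Finset.mem_of_mem_erase hk)) (Finset.ne_of_mem_erase hk)]
  · simp

/-- Convolution of a Gaussian with a Gaussian times the form of a traceless tensor. -/
theorem integral_tensorForm_mul_exp_mul_exp {n : ℕ} [NeZero D] {T : Tens D n}
    (hT : T ∈ symTraceless D n) (v : E D) {s t : ℝ} (hs : 0 < s) (ht : 0 < t) :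
    ∫ w : E D, tensorForm T w * Real.exp (-(‖v - w‖ ^ 2 * s)) * Real.exp (-(‖w‖ ^ 2 * t)) =
      (Real.pi / (s + t)) ^ ((D : ℝ) / 2) * (s / (s + t)) ^ n *
        Real.exp (-(‖v‖ ^ 2 * (s * t / (s + t)))) * tensorForm T v := by
  have hst : 0 < s + t := by positivity
  -- The shift completes the square: with `w = u + (s / (s + t)) v`, `s |v - w|² + t |w|² = (s + t)
  -- |u|² + (s t / (s + t)) |v|²`.
  rw [← integral_add_right_eq_self _ ((s / (s + t)) • v)]
  have h1 : ∀ u : E D, tensorForm T (u + (s / (s + t)) • v) *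
      Real.exp (-(‖v - (u + (s / (s + t)) • v)‖ ^ 2 * s)) *
      Real.exp (-(‖u + (s / (s + t)) • v‖ ^ 2 * t)) =
      Real.exp (-(‖v‖ ^ 2 * (s * t / (s + t)))) *
        (tensorForm T (u + (s / (s + t)) • v) * Real.exp (-(s + t) * ‖u‖ ^ 2)) := fun u => by
    have h2 : Real.exp (-(‖v - (u + (s / (s + t)) • v)‖ ^ 2 * s)) *
        Real.exp (-(‖u + (s / (s + t)) • v‖ ^ 2 * t)) =
        Real.exp (-(‖v‖ ^ 2 * (s * t / (s + t)))) * Real.exp (-(s + t) * ‖u‖ ^ 2) := by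
      rw [← Real.exp_add, ← Real.exp_add]
      congr 1
      have h3 : v - (u + (s / (s + t)) • v) = (t / (s + t)) • v - u := by
        have : t / (s + t) = 1 - s / (s + t) := by field_simp; ring
        rw [this, sub_smul, one_smul]
        abel
      rw [h3, norm_sub_sq_real, norm_add_sq_real, inner_smul_left, inner_smul_right, norm_smul,
        norm_smul, real_inner_comm u v]
      simp only [mul_pow, Real.norm_eq_abs, sq_abs, conj_trivial]
      field_simp
      ring
    rw [mul_assoc, h2]
    ring
  simp only [h1]
  rw [integral_const_mul, integral_tensorForm_add_mul_exp hst hT, tensorForm_smul]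
  ring

end Gaussian

/-! ### Integrability of products of Riesz kernels -/

section RieszKernels

variable {D : ℕ} {A B : ℝ}

theorem nontrivial_euclideanSpace [NeZero D] : Nontrivial (E D) := by
  have : Nonempty (Fin D) := ⟨0⟩
  infer_instance

theorem pow_pred_mul_rpow_neg [NeZero D] (A : ℝ) {r : ℝ} (hr : 0 < r) :
    r ^ (Module.finrank ℝ (E D) - 1) • r ^ (-A) = r ^ ((D : ℝ) - 1 - A) := by
  have h1 : 1 ≤ D := NeZero.one_le
  rw [finrank_euclideanSpace_fin, smul_eq_mul, ← Real.rpow_natCast, ← Real.rpow_add hr,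
    Nat.cast_sub h1]
  congr 1
  push_cast
  ring

theorem integrable_indicator_ball_norm_rpow_neg [NeZero D] (hA : A < D) (r : ℝ) :
    Integrable ((Metric.ball (0 : E D) r).indicator fun w => ‖w‖ ^ (-A)) := by
  have := nontrivial_euclideanSpace (D := D)
  rw [integrable_indicator_iff Metric.isOpen_ball.measurableSet,
    integrableOn_fun_norm_addHaar volume (f := fun x => x ^ (-A))]
  rcases le_or_gt r 0 with hr | hr
  · simp [Ioo_eq_empty (not_lt.mpr hr)]
  · have h : IntegrableOn (fun x : ℝ => x ^ ((D : ℝ) - 1 - A)) (Ioo 0 r) := by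
      refine IntegrableOn.mono_set ?_ Ioo_subset_Ioc_self
      rw [← intervalIntegrable_iff_integrableOn_Ioc_of_le hr.le]
      exact intervalIntegral.intervalIntegrable_rpow' (by linarith)
    exact h.congr_fun (fun x hx => (pow_pred_mul_rpow_neg A hx.1).symm) measurableSet_Ioo

theorem integrable_indicator_compl_ball_norm_rpow_neg [NeZero D] (hA : D < A) {r : ℝ} (hr : 0 < r) :
    Integrable ((Metric.ball (0 : E D) r)ᶜ.indicator fun w => ‖w‖ ^ (-A)) := by
  have := nontrivial_euclideanSpace (D := D)
  have h0 : ((Metric.ball (0 : E D) r)ᶜ.indicator fun w => ‖w‖ ^ (-A)) =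
      fun w => (Ici r).indicator (fun x => x ^ (-A)) ‖w‖ := by
    ext w
    by_cases hw : ‖w‖ < r
    · simp [indicator, hw]
    · simp [indicator, hw, not_lt.mp hw]
  rw [h0, integrable_fun_norm_addHaar volume (f := (Ici r).indicator (fun x => x ^ (-A)))]
  have h : IntegrableOn (fun x : ℝ => x ^ ((D : ℝ) - 1 - A)) (Ici r) := by
    rw [integrableOn_Ici_iff_integrableOn_Ioi]
    exact integrableOn_Ioi_rpow_of_lt (by linarith) hr
  refine IntegrableOn.congr_fun (f := (Ici r).indicator fun x : ℝ => x ^ ((D : ℝ) - 1 - A)) ?_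
    (fun x hx => ?_) measurableSet_Ioi
  · exact (h.integrable_indicator measurableSet_Ici).integrableOn
  · by_cases hxr : r ≤ x
    · simpa [indicator, hxr] using (pow_pred_mul_rpow_neg A hx).symm
    · simp [indicator, hxr]

/-- A product of two Riesz kernels is integrable. -/
theorem integrable_norm_rpow_mul_norm_sub_rpow [NeZero D] {v : E D} (hv : v ≠ 0) (hA0 : 0 ≤ A)
    (hA : A < D) (hB0 : 0 ≤ B) (hB : B < D) (hAB : D < A + B) :
    Integrable fun w : E D => ‖w‖ ^ (-A) * ‖v - w‖ ^ (-B) := by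
  -- The balls of radius `‖v‖ / 2` about `0` and `v` are disjoint, so near each singularity the
  -- other factor is bounded. Outside both, `‖w‖ ≤ ‖v‖ + ‖v - w‖ ≤ 3 ‖v - w‖`, which yields the
  -- constant `3 ^ B` and the tail `‖w‖ ^ (-(A + B))`.
  set r := ‖v‖ / 2 with hr
  have hr0 : 0 < r := by positivity
  have h1 := (integrable_indicator_ball_norm_rpow_neg hA r).mul_const (r ^ (-B))
  have h2 := ((integrable_indicator_ball_norm_rpow_neg hB r).comp_sub_left v).const_mul (r ^ (-A))
  have h3 := (integrable_indicator_compl_ball_norm_rpow_neg hAB hr0).const_mul (3 ^ B)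
  refine ((h1.add h2).add h3).mono' (by fun_prop) (Filter.Eventually.of_forall fun w => ?_)
  have hle : ‖v‖ ≤ ‖w‖ + ‖v - w‖ := by simpa using norm_add_le w (v - w)
  have hle' : ‖w‖ ≤ ‖v‖ + ‖v - w‖ := by
    have := norm_sub_le v (v - w)
    simpa using this
  have p1 : 0 ≤ (Metric.ball (0 : E D) r).indicator (fun w => ‖w‖ ^ (-A)) w * r ^ (-B) :=
    mul_nonneg (indicator_nonneg (fun _ _ => by positivity) _) (by positivity)
  have p2 : 0 ≤ r ^ (-A) * (Metric.ball (0 : E D) r).indicator (fun w => ‖w‖ ^ (-B)) (v - w) :=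
    mul_nonneg (by positivity) (indicator_nonneg (fun _ _ => by positivity) _)
  have p3 : 0 ≤ 3 ^ B * (Metric.ball (0 : E D) r)ᶜ.indicator (fun w => ‖w‖ ^ (-(A + B))) w :=
    mul_nonneg (by positivity) (indicator_nonneg (fun _ _ => by positivity) _)
  rw [Real.norm_of_nonneg (by positivity)]
  simp only [Pi.add_apply]
  by_cases hw : ‖w‖ < r
  · have hvw : r ≤ ‖v - w‖ := by linarith
    have : ‖w‖ ^ (-A) * ‖v - w‖ ^ (-B) ≤
        (Metric.ball (0 : E D) r).indicator (fun w => ‖w‖ ^ (-A)) w * r ^ (-B) := by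
      rw [indicator_of_mem (by simpa using hw)]
      exact mul_le_mul_of_nonneg_left
        (Real.rpow_le_rpow_of_nonpos hr0 hvw (neg_nonpos.mpr hB0)) (by positivity)
    linarith
  by_cases hvw : ‖v - w‖ < r
  · have : ‖w‖ ^ (-A) * ‖v - w‖ ^ (-B) ≤
        r ^ (-A) * (Metric.ball (0 : E D) r).indicator (fun w => ‖w‖ ^ (-B)) (v - w) := by
      rw [indicator_of_mem (by simpa using hvw)]
      exact mul_le_mul_of_nonneg_right
        (Real.rpow_le_rpow_of_nonpos hr0 (not_lt.mp hw) (neg_nonpos.mpr hA0)) (by positivity)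
    linarith
  · rw [not_lt] at hw hvw
    have hw0 : 0 < ‖w‖ := by linarith
    have : ‖w‖ ^ (-A) * ‖v - w‖ ^ (-B) ≤
        3 ^ B * (Metric.ball (0 : E D) r)ᶜ.indicator (fun w => ‖w‖ ^ (-(A + B))) w := by
      rw [indicator_of_mem (by simpa using hw), neg_add, Real.rpow_add hw0]
      have h4 : ‖v - w‖ ^ (-B) ≤ 3 ^ B * ‖w‖ ^ (-B) := by
        refine (Real.rpow_le_rpow_of_nonpos (x := ‖w‖ / 3) (by positivity) (by linarith)
          (by linarith)).trans_eq ?_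
        rw [Real.div_rpow hw0.le (by norm_num), Real.rpow_neg (by norm_num : (0 : ℝ) ≤ 3)]
        field_simp
      calc _ ≤ ‖w‖ ^ (-A) * (3 ^ B * ‖w‖ ^ (-B)) := by gcongr
        _ = _ := by ring
    linarith

end RieszKernels

/-! ### The convolution integral -/

section Star

variable {D n : ℕ} {α β : ℂ}

theorem measurable_sqPow (s : ℂ) : Measurable fun w : E D => sqPow w s := by
  unfold sqPow
  fun_prop

theorem norm_sqPow {w : E D} (hw : w ≠ 0) (s : ℂ) : ‖sqPow w s‖ = ‖w‖ ^ (2 * s.re) := by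
  have hw0 : 0 < ‖w‖ := norm_pos_iff.mpr hw
  rw [sqPow, Complex.norm_cpow_eq_rpow_re_of_pos (by positivity), ← Real.rpow_natCast,
    ← Real.rpow_mul hw0.le]
  norm_num

theorem sqPow_ne_zero {w : E D} (hw : w ≠ 0) (s : ℂ) : sqPow w s ≠ 0 := by
  rw [← norm_ne_zero_iff, norm_sqPow hw]
  have : 0 < ‖w‖ := norm_pos_iff.mpr hw
  positivity

theorem ae_ne [NeZero D] (v : E D) : ∀ᵐ w : E D, w ≠ v := by
  have := nontrivial_euclideanSpace (D := D)
  exact Measure.ae_ne volume v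

theorem integrable_star [NeZero D] (T : Tens D n) (h : (α, β) ∈ convergenceDomain D n)
    {v : E D} (hv : v ≠ 0) :
    Integrable fun w : E D => (tensorForm T w : ℂ) / sqPow w (α + β) /
      sqPow (v - w) (dualIndex D β) := by
  obtain ⟨h1, h2, h3⟩ := h
  simp only at h1 h2 h3
  have hn : (0 : ℝ) ≤ n := Nat.cast_nonneg n
  -- The domain matches the singularities: `A < D` is `Re (α + β) < (D + n)/2`, `B < D` is `Re β >
  -- 0`, and `D < A + B` is `Re α > n/2`.
  have hint := (integrable_norm_rpow_mul_norm_sub_rpow hv (A := 2 * (α.re + β.re) - n)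
    (B := D - 2 * β.re) (by linarith) (by linarith) (by linarith) (by linarith)
    (by linarith)).const_mul (∑ ρ, |T ρ|)
  have m1 := (continuous_tensorForm T).measurable
  have m2 := measurable_sqPow (D := D) (α + β)
  have m3 := (measurable_sqPow (dualIndex D β)).comp
    (measurable_const.sub measurable_id : Measurable fun w : E D => v - w)
  refine hint.mono' (((Complex.measurable_ofReal.comp m1).div m2).div m3).aestronglyMeasurable ?_
  filter_upwards [ae_ne 0, ae_ne v] with w hw hwv
  have hw0 : 0 < ‖w‖ := norm_pos_iff.mpr hw
  have hvw : v - w ≠ 0 := sub_ne_zero.mpr hwv.symm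
  rw [norm_div, norm_div, norm_sqPow hw, norm_sqPow hvw, Complex.norm_real, Real.norm_eq_abs]
  have e1 : ‖v - w‖ ^ (-(D - 2 * β.re)) = (‖v - w‖ ^ (2 * (dualIndex D β).re))⁻¹ := by
    rw [← Real.rpow_neg (norm_nonneg _)]
    congr 1
    simp [dualIndex]
    ring
  have e2 : ‖w‖ ^ (-(2 * (α.re + β.re) - n)) = ‖w‖ ^ n / ‖w‖ ^ (2 * (α + β).re) := by
    rw [← Real.rpow_natCast, ← Real.rpow_sub hw0]
    congr 1
    simp
  rw [e1, e2, div_eq_mul_inv _ (‖v - w‖ ^ _), ← mul_assoc, mul_div_assoc']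
  gcongr
  exact abs_tensorForm_le T w

theorem ofReal_div_rpow_eq {x y : ℝ} (hx : 0 < x) (hy : 0 < y) (d : ℝ) :
    (((x / y) ^ d : ℝ) : ℂ) = (x : ℂ) ^ (d : ℂ) / (y : ℂ) ^ (d : ℂ) := by
  rw [Real.div_rpow hx.le hy.le, Complex.ofReal_div, Complex.ofReal_cpow hx.le,
    Complex.ofReal_cpow hy.le]

/-- The integral over the two Schwinger parameters, in the variables `s` and `x = t / s`. -/
theorem schwinger_integral_eq [NeZero D] (T : Tens D n) (v : E D) {s : ℝ} (hs : 0 < s) :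
    (s : ℂ) ^ (dualIndex D β - 1) * ∫ t in Ioi (0 : ℝ), (t : ℂ) ^ (α + β - 1) *
      (((Real.pi / (s + t)) ^ ((D : ℝ) / 2) * (s / (s + t)) ^ n *
        Real.exp (-(‖v‖ ^ 2 * (s * t / (s + t)))) * tensorForm T v : ℝ) : ℂ) =
    ((Real.pi : ℂ) ^ ((D : ℂ) / 2) * tensorForm T v) * ((s : ℂ) ^ (α - 1) *
      ∫ x in Ioi (0 : ℝ), (x : ℂ) ^ (α + β - 1) / ((1 + x : ℝ) : ℂ) ^ ((n : ℂ) + D / 2) *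
        Complex.exp (-((‖v‖ ^ 2 * (x / (1 + x)) : ℝ) * s))) := by
  have hs0 : (s : ℂ) ≠ 0 := by exact_mod_cast hs.ne'
  rw [← integral_const_mul, ← integral_const_mul, ← integral_const_mul]
  set g : ℝ → ℂ := fun t => (s : ℂ) ^ (dualIndex D β - 1) * ((t : ℂ) ^ (α + β - 1) *
      (((Real.pi / (s + t)) ^ ((D : ℝ) / 2) * (s / (s + t)) ^ n *
        Real.exp (-(‖v‖ ^ 2 * (s * t / (s + t)))) * tensorForm T v : ℝ) : ℂ)) with hg
  -- Substitution `t = s x`; its Jacobian `s` supplies the power missing in `e3` below.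
  have hsub := integral_comp_mul_left_Ioi g 0 hs
  rw [mul_zero, eq_comm, inv_smul_eq_iff₀ hs.ne'] at hsub
  rw [hsub, ← integral_smul]
  refine setIntegral_congr_fun measurableSet_Ioi fun x hx => ?_
  have hx : 0 < x := hx
  have h1x : 0 < 1 + x := by linarith
  have hc : ((1 + x : ℝ) : ℂ) ≠ 0 := by exact_mod_cast h1x.ne'
  have e0 : s + s * x = s * (1 + x) := by ring
  have e1 : s * (s * x) / (s * (1 + x)) = x / (1 + x) * s := by field_simp
  have e2 : s / (s * (1 + x)) = 1 / (1 + x) := by field_simp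
  simp only [hg, e0, e1, e2]
  have e7 : ∀ a b c d : ℝ, ((a * b * c * d : ℝ) : ℂ) = a * b * c * d := fun a b c d => by
    push_cast
    rfl
  rw [e7, ofReal_div_rpow_eq Real.pi_pos (by positivity), Complex.ofReal_mul s x,
    Complex.ofReal_mul s (1 + x), Complex.mul_cpow_ofReal_nonneg hs.le hx.le,
    Complex.mul_cpow_ofReal_nonneg hs.le h1x.le,
    Complex.cpow_add _ _ hc, Complex.cpow_natCast, Complex.real_smul]
  have e3 : (s : ℂ) ^ (α - 1) * (s : ℂ) ^ ((D : ℂ) / 2) =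
      s * ((s : ℂ) ^ (dualIndex D β - 1) * (s : ℂ) ^ (α + β - 1)) := by
    nth_rewrite 3 [← Complex.cpow_one (s : ℂ)]
    rw [← Complex.cpow_add _ _ hs0, ← Complex.cpow_add _ _ hs0, ← Complex.cpow_add _ _ hs0]
    congr 1
    rw [dualIndex]
    ring
  have e4 : (((1 / (1 + x)) ^ n : ℝ) : ℂ) = 1 / ((1 + x : ℝ) : ℂ) ^ n := by
    push_cast
    rw [div_pow, one_pow]
  have e5 : ((Real.exp (-(‖v‖ ^ 2 * (x / (1 + x) * s))) : ℝ) : ℂ) =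
      Complex.exp (-((‖v‖ ^ 2 * (x / (1 + x)) : ℝ) * s)) := by
    push_cast
    congr 1
    ring
  have e6 : (((D : ℝ) / 2 : ℝ) : ℂ) = (D : ℂ) / 2 := by push_cast; rfl
  rw [e4, e5, e6]
  have hsD : (s : ℂ) ^ ((D : ℂ) / 2) ≠ 0 := by simp [Complex.cpow_eq_zero_iff, hs0]
  rw [← eq_div_iff hsD] at e3
  rw [e3]
  ring

/-- The convolution of `T(w) / w^{2(α+β)}` with `1 / w^{2β'}`, for the form `T` of a symmetric
traceless tensor. -/
theorem integral_star [NeZero D] {T : Tens D n} (hT : T ∈ symTraceless D n)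
    (h : (α, β) ∈ convergenceDomain D n) {v : E D} (hv : v ≠ 0) :
    ∫ w : E D, (tensorForm T w : ℂ) / sqPow w (α + β) / sqPow (v - w) (dualIndex D β) =
      (Real.pi : ℂ) ^ ((D : ℂ) / 2) * Complex.Gamma β * Complex.Gamma α *
        Complex.Gamma (dualIndex D α - β + n) /
        (Complex.Gamma (dualIndex D β) * Complex.Gamma (dualIndex D α + n) *
          Complex.Gamma (α + β)) * (tensorForm T v / sqPow v α) := by
  have hint := integrable_star T h hv
  obtain ⟨h1, h2, h3⟩ := h
  simp only at h1 h2 h3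
  have hn : (0 : ℝ) ≤ n := Nat.cast_nonneg n
  have ha : 0 < (α + β).re := by rw [Complex.add_re]; linarith
  have hα : 0 < α.re := by linarith
  have hb : 0 < (dualIndex D β).re := by simp [dualIndex]; linarith
  have hp : 0 < (dualIndex D α - β + n).re := by simp [dualIndex]; linarith
  have hr : 0 < ‖v‖ := norm_pos_iff.mpr hv
  have mT : Measurable fun w => (tensorForm T w : ℂ) :=
    Complex.measurable_ofReal.comp (continuous_tensorForm T).measurable
  have m1 : Measurable fun w : E D => (tensorForm T w : ℂ) / sqPow w (α + β) :=
    mT.div (measurable_sqPow (D := D) (α + β))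
  have m2 : Measurable fun w : E D => ‖v - w‖ ^ 2 := by fun_prop
  have m3 : Measurable fun w : E D => ‖w‖ ^ 2 := by fun_prop
  have pos1 : ∀ᵐ w : E D, 0 < ‖v - w‖ ^ 2 := by
    filter_upwards [ae_ne v] with w hw
    have := norm_pos_iff.mpr (sub_ne_zero.mpr hw.symm)
    positivity
  have pos2 : ∀ᵐ w : E D, 0 < ‖w‖ ^ 2 := by
    filter_upwards [ae_ne 0] with w hw
    have := norm_pos_iff.mpr hw
    positivity
  have step1 := Gamma_mul_integral_div_cpow m1 m2 pos1 hb hint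
  have step2 : ∀ᵐ s : ℝ ∂(volume.restrict (Ioi 0)),
      Complex.Gamma (α + β) * ∫ w : E D, (tensorForm T w : ℂ) / sqPow w (α + β) *
        Complex.exp (-((‖v - w‖ ^ 2 : ℝ) * s)) =
      ∫ t in Ioi (0 : ℝ), (t : ℂ) ^ (α + β - 1) *
      (((Real.pi / (s + t)) ^ ((D : ℝ) / 2) * (s / (s + t)) ^ n *
        Real.exp (-(‖v‖ ^ 2 * (s * t / (s + t)))) * tensorForm T v : ℝ) : ℂ) := by
    -- The parameter `t` is introduced separately for almost every fixed `s`, so each use of Fubini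
    -- involves one parameter only.
    filter_upwards [ae_integrable_mul_exp m1 m2 pos1 hb hint, ae_restrict_mem measurableSet_Ioi]
      with s hs hs0
    have hs0 : 0 < s := hs0
    have hcomm : ∀ w : E D, (tensorForm T w : ℂ) / sqPow w (α + β) *
        Complex.exp (-((‖v - w‖ ^ 2 : ℝ) * s)) =
        (tensorForm T w : ℂ) * Complex.exp (-((‖v - w‖ ^ 2 : ℝ) * s)) /
          ((‖w‖ ^ 2 : ℝ) : ℂ) ^ (α + β) := fun w => div_mul_eq_mul_div _ _ _
    simp only [hcomm] at hs ⊢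
    have m4 : Measurable fun w : E D =>
        (tensorForm T w : ℂ) * Complex.exp (-((‖v - w‖ ^ 2 : ℝ) * s)) := mT.mul (by fun_prop)
    rw [Gamma_mul_integral_div_cpow m4 m3 pos2 ha hs]
    refine setIntegral_congr_fun measurableSet_Ioi fun t ht => ?_
    rw [← integral_tensorForm_mul_exp_mul_exp hT v hs0 ht, ← integral_complex_ofReal]
    congr 2 with w
    push_cast
    rfl
  have step3 : Complex.Gamma (α + β) * (Complex.Gamma (dualIndex D β) *
      ∫ w : E D, (tensorForm T w : ℂ) / sqPow w (α + β) / sqPow (v - w) (dualIndex D β)) =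
      ((Real.pi : ℂ) ^ ((D : ℂ) / 2) * tensorForm T v) * ∫ s in Ioi (0 : ℝ), (s : ℂ) ^ (α - 1) *
      ∫ x in Ioi (0 : ℝ), (x : ℂ) ^ (α + β - 1) / ((1 + x : ℝ) : ℂ) ^ ((n : ℂ) + D / 2) *
        Complex.exp (-((‖v‖ ^ 2 * (x / (1 + x)) : ℝ) * s)) := by
    refine (congrArg (Complex.Gamma (α + β) * ·) step1).trans ?_
    rw [← integral_const_mul, ← integral_const_mul]
    refine integral_congr_ae ?_
    filter_upwards [step2, ae_restrict_mem measurableSet_Ioi] with s hs hs0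
    rw [mul_left_comm, hs, schwinger_integral_eq T v hs0]
  have hH : ∀ x : ℝ, 0 < x → (x : ℂ) ^ (α + β - 1) / ((1 + x : ℝ) : ℂ) ^ ((n : ℂ) + D / 2) /
      ((‖v‖ ^ 2 * (x / (1 + x)) : ℝ) : ℂ) ^ α = (sqPow v α)⁻¹ *
      ((x : ℂ) ^ (β - 1) / ((1 + x : ℝ) : ℂ) ^ (dualIndex D α - β + n + β)) := fun x hx => by
    have h1x : 0 < 1 + x := by linarith
    have hx0 : (x : ℂ) ≠ 0 := by exact_mod_cast hx.ne'
    have hc : ((1 + x : ℝ) : ℂ) ≠ 0 := by exact_mod_cast h1x.ne'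
    have hc' : ((1 + x : ℝ) : ℂ) ^ α ≠ 0 := by simp only [Ne, Complex.cpow_eq_zero_iff]; tauto
    have hx' : (x : ℂ) ^ α ≠ 0 := by simp only [Ne, Complex.cpow_eq_zero_iff]; tauto
    rw [div_eq_mul_inv x, Complex.ofReal_mul (‖v‖ ^ 2),
      Complex.mul_cpow_ofReal_nonneg (by positivity) (by positivity), Complex.ofReal_mul x,
      Complex.mul_cpow_ofReal_nonneg hx.le (by positivity), ← one_div, Complex.ofReal_div,
      Complex.ofReal_one, ofReal_one_div_cpow h1x,
      show dualIndex D α - β + n + β = (n + D / 2) - α by rw [dualIndex]; ring,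
      Complex.cpow_sub _ _ hc, show α + β - 1 = α + (β - 1) by ring, Complex.cpow_add _ _ hx0,
      sqPow]
    field_simp
  have posN : ∀ᵐ x : ℝ ∂(volume.restrict (Ioi 0)), 0 < ‖v‖ ^ 2 * (x / (1 + x)) := by
    filter_upwards [ae_restrict_mem measurableSet_Ioi] with x hx
    have hx : 0 < x := hx
    positivity
  have hbeta := (integrableOn_beta hp h1).const_mul (sqPow v α)⁻¹
  -- The Schwinger formula is now read backwards, with `s` as the parameter: the `s`-integral gives
  -- `Γ(α)` and leaves `x^{β-1} / (1 + x)^{α'+n}`, a beta integrand.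
  have step4 := Gamma_mul_integral_div_cpow (μ := volume.restrict (Ioi (0 : ℝ)))
    (H := fun x : ℝ => (x : ℂ) ^ (α + β - 1) / ((1 + x : ℝ) : ℂ) ^ ((n : ℂ) + D / 2))
    (N := fun x : ℝ => ‖v‖ ^ 2 * (x / (1 + x))) (by fun_prop) (by fun_prop) posN hα
    (IntegrableOn.congr_fun hbeta (fun x hx => (hH x hx).symm) measurableSet_Ioi)
  rw [setIntegral_congr_fun measurableSet_Ioi hH, integral_const_mul] at step4
  have step5 := integral_beta hp h1
  have hsum : dualIndex D α - β + n + β = dualIndex D α + n := by ring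
  have hq : 0 < (dualIndex D α + n).re := by rw [← hsum, Complex.add_re]; linarith
  rw [hsum] at step4 step5
  rw [← step4] at step3
  have g1 := Complex.Gamma_ne_zero_of_re_pos ha
  have g2 := Complex.Gamma_ne_zero_of_re_pos hb
  have g3 := Complex.Gamma_ne_zero_of_re_pos hq
  rw [mul_comm, ← eq_div_iff g3] at step5
  rw [← mul_assoc, mul_comm, ← eq_div_iff (mul_ne_zero g1 g2), step5] at step3
  rw [step3]
  have := sqPow_ne_zero hv α
  field_simp

end Star

/-! ### Inversion as a change of variables -/

section Inversion

variable {D : ℕ}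

theorem inversion_eq_inversion (x : E D) : inversion x = EuclideanGeometry.inversion 0 1 x := by
  simp [inversion, EuclideanGeometry.inversion]

theorem inversion_inversion (x : E D) : inversion (inversion x) = x := by
  rw [inversion_eq_inversion, inversion_eq_inversion,
    EuclideanGeometry.inversion_inversion _ one_ne_zero]

theorem inversion_ne_zero {x : E D} (hx : x ≠ 0) : inversion x ≠ 0 := by
  rwa [inversion_eq_inversion, Ne, EuclideanGeometry.inversion_eq_center one_ne_zero]

theorem inversion_injective : Function.Injective (inversion : E D → E D) :=
  Function.LeftInverse.injective inversion_inversion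

theorem norm_inversion (x : E D) : ‖inversion x‖ = ‖x‖⁻¹ := by
  have := EuclideanGeometry.dist_inversion_center (0 : E D) x 1
  rw [inversion_eq_inversion]
  simpa using this

theorem norm_inversion_sub_inversion {x y : E D} (hx : x ≠ 0) (hy : y ≠ 0) :
    ‖inversion x - inversion y‖ = ‖x - y‖ / (‖x‖ * ‖y‖) := by
  have := EuclideanGeometry.dist_inversion_inversion hx hy 1
  rw [inversion_eq_inversion, inversion_eq_inversion, ← dist_eq_norm, this]
  simp [dist_eq_norm]
  ring

theorem hasFDerivAt_inversion {x : E D} (hx : x ≠ 0) :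
    HasFDerivAt inversion ((1 / ‖x‖) ^ 2 • ((ℝ ∙ x)ᗮ.reflection : E D →L[ℝ] E D)) x := by
  have h := EuclideanGeometry.hasFDerivAt_inversion (R := 1) hx
  have h0 : (inversion : E D → E D) = EuclideanGeometry.inversion 0 1 :=
    funext inversion_eq_inversion
  rw [h0]
  simpa using h

theorem abs_det_smul_reflection (K : Submodule ℝ (E D)) (c : ℝ) :
    |(c • (K.reflection : E D →L[ℝ] E D)).det| = |c| ^ D := by
  have h : (c • (K.reflection : E D →L[ℝ] E D)).det =
      c ^ Module.finrank ℝ (E D) * LinearMap.det K.reflection.toLinearMap :=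
    LinearMap.det_smul c _
  rw [h, Submodule.det_reflection, finrank_euclideanSpace_fin, abs_mul, abs_pow, abs_pow]
  simp

theorem image_inversion_compl_zero : inversion '' ({0}ᶜ : Set (E D)) = {0}ᶜ := by
  ext z
  constructor
  · rintro ⟨x, hx, rfl⟩
    exact inversion_ne_zero hx
  · intro hz
    exact ⟨inversion z, inversion_ne_zero hz, inversion_inversion z⟩

/-- The derivative of inversion is `‖x‖⁻²` times a reflection, whose determinant has modulus `1`. -/
theorem abs_det_fderiv_inversion (x : E D) :
    |((1 / ‖x‖) ^ 2 • ((ℝ ∙ x)ᗮ.reflection : E D →L[ℝ] E D)).det| = (‖x‖ ^ (2 * D))⁻¹ := by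
  rw [abs_det_smul_reflection, abs_of_nonneg (by positivity), one_div, inv_pow, inv_pow, ← pow_mul]

theorem restrict_compl_zero [NeZero D] :
    (volume : Measure (E D)).restrict {0}ᶜ = volume := by
  have := nontrivial_euclideanSpace (D := D)
  exact restrict_compl_singleton 0

theorem integral_inversion [NeZero D] (G : E D → ℂ) :
    ∫ x, G x = ∫ x, (‖x‖ ^ (2 * D))⁻¹ • G (inversion x) := by
  have h := integral_image_eq_integral_abs_det_fderiv_smul volume
    (measurableSet_singleton (0 : E D)).compl
    (fun x hx => (hasFDerivAt_inversion hx).hasFDerivWithinAt) inversion_injective.injOn G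
  simpa only [image_inversion_compl_zero, restrict_compl_zero, abs_det_fderiv_inversion] using h

theorem integrable_inversion_iff [NeZero D] (G : E D → ℂ) :
    Integrable G ↔ Integrable fun x => (‖x‖ ^ (2 * D))⁻¹ • G (inversion x) := by
  have h := integrableOn_image_iff_integrableOn_abs_det_fderiv_smul volume
    (measurableSet_singleton (0 : E D)).compl
    (fun x hx => (hasFDerivAt_inversion hx).hasFDerivWithinAt) inversion_injective.injOn G
  simpa only [image_inversion_compl_zero, IntegrableOn, restrict_compl_zero,
    abs_det_fderiv_inversion] using h

end Inversion

/-! ### Complex powers under inversion -/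

section SqPow

variable {D : ℕ}

theorem sqPow_add {x : E D} (hx : x ≠ 0) (s t : ℂ) : sqPow x (s + t) = sqPow x s * sqPow x t := by
  rw [sqPow, Complex.cpow_add, ← sqPow, ← sqPow]
  have := norm_pos_iff.mpr hx
  exact_mod_cast (by positivity : ‖x‖ ^ 2 ≠ 0)

theorem sqPow_natCast (x : E D) (k : ℕ) : sqPow x k = ((‖x‖ ^ (2 * k) : ℝ) : ℂ) := by
  rw [sqPow, Complex.cpow_natCast, pow_mul]
  push_cast
  rfl

theorem sqPow_sub_comm (x y : E D) (s : ℂ) : sqPow (x - y) s = sqPow (y - x) s := by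
  rw [sqPow, norm_sub_rev, ← sqPow]

theorem sqPow_inversion {x : E D} (s : ℂ) : sqPow (inversion x) s = (sqPow x s)⁻¹ := by
  rw [sqPow, norm_inversion, inv_pow, Complex.ofReal_inv, Complex.inv_cpow, ← sqPow]
  rw [Complex.arg_ofReal_of_nonneg (by positivity)]
  exact Real.pi_pos.ne

theorem sqPow_inversion_sub_inversion {x y : E D} (hx : x ≠ 0) (hy : y ≠ 0) (s : ℂ) :
    sqPow (inversion x - inversion y) s = sqPow (x - y) s / (sqPow x s * sqPow y s) := by
  have h : ‖inversion x - inversion y‖ ^ 2 = ‖x - y‖ ^ 2 * ((‖x‖ ^ 2)⁻¹ * (‖y‖ ^ 2)⁻¹) := by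
    rw [norm_inversion_sub_inversion hx hy, div_pow, mul_pow, div_eq_mul_inv, mul_inv]
  rw [sqPow, h, Complex.ofReal_mul, Complex.mul_cpow_ofReal_nonneg (by positivity) (by positivity),
    Complex.ofReal_mul, Complex.mul_cpow_ofReal_nonneg (by positivity) (by positivity), ← inv_pow,
    ← inv_pow, ← norm_inversion, ← norm_inversion]
  change sqPow (x - y) s * (sqPow (inversion x) s * sqPow (inversion y) s) = _
  rw [sqPow_inversion, sqPow_inversion]
  ring

end SqPow

/-! ### The conformal triangle in inverted coordinates -/

section Triangle

variable {D n : ℕ} {α β : ℂ}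

/-- The symmetric traceless tensor whose form is the component `μ` of the traceless power. -/
def tracelessUnit {D n : ℕ} (μ : Fin n → Fin D) : Tens D n :=
  (symTraceless D n).starProjection (EuclideanSpace.single μ 1)

theorem tracelessUnit_mem (μ : Fin n → Fin D) : tracelessUnit μ ∈ symTraceless D n :=
  Submodule.starProjection_apply_mem _ _

/-- The orthogonal projector is self-adjoint, so it moves from `v^{⊗n}` to the basis tensor, making
each component the form of a fixed traceless tensor. -/
theorem tracelessPow_apply (v : E D) (μ : Fin n → Fin D) :
    tracelessPow n v μ = tensorForm (tracelessUnit μ) v := by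
  have h := Submodule.inner_starProjection_left_eq_right (symTraceless D n)
    (EuclideanSpace.single μ 1) (tensorPow n v)
  rw [EuclideanSpace.inner_single_left] at h
  rw [tracelessPow]
  simp only [map_one, one_mul] at h
  rw [← h, tensorForm, tracelessUnit, PiLp.inner_apply]
  exact Finset.sum_congr rfl fun ρ _ => by simp [tensorPow, mul_comm]

theorem p1Integrand_conformalTriangle (μ : Fin n → Fin D) {u u₁ u₂ y : E D} (hu : u ≠ 0)
    (hu₁ : u₁ ≠ 0) (hu₂ : u₂ ≠ 0) (h : u ≠ u₁) :
    (‖u‖ ^ (2 * D))⁻¹ • p1Integrand β (q12NegPow β (conformalTriangle α β y μ))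
      (y - inversion u₂) (y - inversion u₁) (y - inversion u) =
    sqPow u₁ ((D : ℂ) / 2) * sqPow u₂ (dualIndex D β) *
      ((tensorForm (tracelessUnit μ) (u - u₁) : ℂ) / sqPow (u - u₁) (α + β) /
        sqPow (u₂ - u₁ - (u - u₁)) (dualIndex D β)) := by
  -- The exponents attached to `u` satisfy `α + β + α' + β' = D`, so they cancel the Jacobian.
  have hD : ((‖u‖ ^ (2 * D) : ℝ) : ℂ) =
      sqPow u α * sqPow u β * (sqPow u (dualIndex D α) * sqPow u (dualIndex D β)) := by
    rw [← sqPow_add hu, ← sqPow_add hu, ← sqPow_add hu, ← sqPow_natCast]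
    congr 1
    simp only [dualIndex]
    ring
  have hD1 : sqPow u₁ ((D : ℂ) / 2) =
      sqPow u₁ α * sqPow u₁ β * sqPow u₁ (dualIndex D (α + β)) := by
    rw [← sqPow_add hu₁, ← sqPow_add hu₁]
    congr 1
    simp only [dualIndex]
    ring
  simp only [p1Integrand, q12NegPow, conformalTriangle, sub_sub_cancel, inversion_inversion,
    sub_sub_sub_cancel_left, sub_sub_sub_cancel_right, sqPow_inversion,
    sqPow_inversion_sub_inversion hu₁ hu, sqPow_inversion_sub_inversion hu hu₂,
    tracelessPow_apply, Complex.real_smul, Complex.ofReal_inv, hD, hD1]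
  rw [sqPow_sub_comm u₁ u, sqPow_sub_comm u₁ u, sqPow_sub_comm u₂ u]
  rw [sqPow_add (sub_ne_zero.mpr h)]
  have n1 := sqPow_ne_zero hu α
  have n2 := sqPow_ne_zero hu β
  have n3 := sqPow_ne_zero hu (dualIndex D α)
  have n4 := sqPow_ne_zero hu (dualIndex D β)
  have n5 := sqPow_ne_zero hu₁ α
  have n6 := sqPow_ne_zero hu₁ β
  have n7 := sqPow_ne_zero hu₁ (dualIndex D (α + β))
  have n8 := sqPow_ne_zero hu₂ (dualIndex D β)
  have n9 := sqPow_ne_zero (sub_ne_zero.mpr h) α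
  have n10 := sqPow_ne_zero (sub_ne_zero.mpr h) β
  simp only [div_eq_mul_inv, mul_inv, inv_inv]
  field_simp

theorem conformalTriangle_eq (μ : Fin n → Fin D) {u₁ u₂ y : E D} (hu₁ : u₁ ≠ 0) (hu₂ : u₂ ≠ 0)
    (h : u₁ ≠ u₂) :
    conformalTriangle α β y μ (y - inversion u₁) (y - inversion u₂) =
      sqPow u₁ ((D : ℂ) / 2) * sqPow u₂ (dualIndex D β) *
        ((tensorForm (tracelessUnit μ) (u₁ - u₂) : ℂ) / sqPow (u₁ - u₂) α) := by
  have hD1 : sqPow u₁ ((D : ℂ) / 2) = sqPow u₁ α * sqPow u₁ (dualIndex D α) := by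
    rw [← sqPow_add hu₁]
    congr 1
    simp only [dualIndex]
    ring
  have hD2 : sqPow u₂ (dualIndex D β) = sqPow u₂ α * sqPow u₂ (dualIndex D (α + β)) := by
    rw [← sqPow_add hu₂]
    congr 1
    simp only [dualIndex]
    ring
  simp only [conformalTriangle, sub_sub_cancel, inversion_inversion, sub_sub_sub_cancel_left,
    sqPow_inversion, sqPow_inversion_sub_inversion hu₂ hu₁, tracelessPow_apply, hD1, hD2]
  rw [sqPow_sub_comm u₂ u₁]
  have n1 := sqPow_ne_zero hu₁ α
  have n2 := sqPow_ne_zero hu₁ (dualIndex D α)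
  have n3 := sqPow_ne_zero hu₂ α
  have n4 := sqPow_ne_zero hu₂ (dualIndex D (α + β))
  have n5 := sqPow_ne_zero (sub_ne_zero.mpr h) α
  simp only [div_eq_mul_inv, mul_inv, inv_inv]
  field_simp

theorem aCoeff_ne_zero (h1 : 0 < β.re) (h2 : 0 < (dualIndex D β).re) : aCoeff D β ≠ 0 := by
  have h3 := Complex.Gamma_ne_zero_of_re_pos h1
  have h4 := Complex.Gamma_ne_zero_of_re_pos h2
  have h5 : (Real.pi : ℂ) ≠ 0 := by exact_mod_cast Real.pi_ne_zero
  simp [aCoeff, Complex.cpow_eq_zero_iff, h3, h4, h5]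

/-- The eigenvalue equation in the domain of absolute convergence. -/
theorem graphBuilding_conformalTriangle [NeZero D] (h : (α, β) ∈ convergenceDomain D n)
    (μ : Fin n → Fin D) {x₁ x₂ y : E D} (h₁₂ : x₁ ≠ x₂) (h₁ : x₁ ≠ y) (h₂ : x₂ ≠ y) :
    GraphBuildingConverges β (conformalTriangle α β y μ) x₁ x₂ ∧
      graphBuilding β (conformalTriangle α β y μ) x₁ x₂ =
        eigenvalue D n α β * conformalTriangle α β y μ x₁ x₂ := by
  obtain ⟨u₁, rfl⟩ : ∃ u, x₁ = y - inversion u :=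
    ⟨inversion (y - x₁), by rw [inversion_inversion, sub_sub_cancel]⟩
  obtain ⟨u₂, rfl⟩ : ∃ u, x₂ = y - inversion u :=
    ⟨inversion (y - x₂), by rw [inversion_inversion, sub_sub_cancel]⟩
  have hu₁ : u₁ ≠ 0 := by
    rintro rfl
    simp [inversion] at h₁
  have hu₂ : u₂ ≠ 0 := by
    rintro rfl
    simp [inversion] at h₂
  have hu : u₁ ≠ u₂ := fun he => h₁₂ (by rw [he])
  have hv : u₂ - u₁ ≠ 0 := sub_ne_zero.mpr hu.symm
  set F := p1Integrand β (q12NegPow β (conformalTriangle α β y μ))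
    (y - inversion u₂) (y - inversion u₁) with hF
  set c : ℂ := sqPow u₁ ((D : ℂ) / 2) * sqPow u₂ (dualIndex D β) with hc
  set K : E D → ℂ := fun w => (tensorForm (tracelessUnit μ) w : ℂ) / sqPow w (α + β) /
    sqPow (u₂ - u₁ - w) (dualIndex D β) with hK
  have hKint : Integrable K := integrable_star _ h hv
  have hae : (fun u => (‖u‖ ^ (2 * D))⁻¹ • F (y - inversion u)) =ᵐ[volume]
      fun u => c * K (u - u₁) := by
    filter_upwards [ae_ne 0, ae_ne u₁] with u hu0 hu1
    exact p1Integrand_conformalTriangle μ hu0 hu₁ hu₂ hu1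
  have hFint : Integrable fun z => F (y - z) := by
    rw [integrable_inversion_iff]
    exact ((hKint.comp_sub_right u₁).const_mul c).congr hae.symm
  have hFval : ∫ z, F z = c * ∫ w, K w := by
    rw [← integral_sub_left_eq_self F volume y, integral_inversion, integral_congr_ae hae,
      integral_const_mul, integral_sub_right_eq_self K u₁]
  refine ⟨(integrable_comp_sub_left F y).mp hFint, ?_⟩
  have h1 : 0 < β.re := h.1
  have h2 : 0 < (dualIndex D β).re := by
    have h3 : (n : ℝ) / 2 < α.re := h.2.1
    have h4 : α.re + β.re < ((D : ℝ) + n) / 2 := h.2.2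
    simp [dualIndex]
    linarith
  change (aCoeff D β)⁻¹ * (aCoeff D β * ∫ z, F z) = _
  rw [inv_mul_cancel_left₀ (aCoeff_ne_zero h1 h2), hFval, hK,
    integral_star (tracelessUnit_mem μ) h hv, conformalTriangle_eq μ hu₁ hu₂ hu, eigenvalue,
    sqPow_sub_comm u₂ u₁, show u₂ - u₁ = (-1 : ℝ) • (u₁ - u₂) by simp, tensorForm_smul]
  push_cast
  ring

end Triangle

/-! ### Analytic continuation in the parameters -/

section Continuation

variable {D n : ℕ}

/-- `Complex.Gamma` takes the value `0` at its poles and nowhere else, so its inverse is the entire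
function `1/Γ`, poles included. -/
theorem forall_ne_neg_natCast_iff (s : ℂ) : (∀ k : ℕ, s ≠ -(k : ℂ)) ↔ (Complex.Gamma s)⁻¹ ≠ 0 := by
  rw [Ne, inv_eq_zero, Complex.Gamma_eq_zero_iff, not_exists]

theorem mem_regularDomain_iff (p : ℂ × ℂ) : p ∈ regularDomain D n ↔
    (Complex.Gamma p.2)⁻¹ ≠ 0 ∧ (Complex.Gamma p.1)⁻¹ ≠ 0 ∧
      (Complex.Gamma (dualIndex D p.1 - p.2 + n))⁻¹ ≠ 0 := by
  simp only [← forall_ne_neg_natCast_iff, ← forall_and]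
  rfl

theorem continuous_inv_Gamma : Continuous fun s : ℂ => (Complex.Gamma s)⁻¹ :=
  Complex.differentiable_one_div_Gamma.continuous

theorem isOpen_regularDomain : IsOpen (regularDomain D n) := by
  have h : regularDomain D n = {p | (Complex.Gamma p.2)⁻¹ ≠ 0} ∩ ({p | (Complex.Gamma p.1)⁻¹ ≠ 0} ∩
      {p | (Complex.Gamma (dualIndex D p.1 - p.2 + n))⁻¹ ≠ 0}) :=
    Set.ext mem_regularDomain_iff
  rw [h]
  have c : Continuous fun p : ℂ × ℂ => dualIndex D p.1 - p.2 + n := by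
    unfold dualIndex
    fun_prop
  exact ((isOpen_ne_fun (continuous_inv_Gamma.comp continuous_snd) continuous_const).inter
    ((isOpen_ne_fun (continuous_inv_Gamma.comp continuous_fst) continuous_const).inter
      (isOpen_ne_fun (continuous_inv_Gamma.comp c) continuous_const)))

theorem isOpen_convergenceDomain : IsOpen (convergenceDomain D n) := by
  have h1 : Continuous fun p : ℂ × ℂ => p.1.re := by fun_prop
  have h2 : Continuous fun p : ℂ × ℂ => p.2.re := by fun_prop
  exact (isOpen_lt continuous_const h2).inter
    ((isOpen_lt continuous_const h1).inter (isOpen_lt (h1.add h2) continuous_const))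

theorem convergenceDomain_nonempty (hD : 1 ≤ D) : (convergenceDomain D n).Nonempty := by
  have hD' : (1 : ℝ) ≤ D := by exact_mod_cast hD
  refine ⟨(((n / 2 + 1 / 8 : ℝ) : ℂ), ((1 / 8 : ℝ) : ℂ)), ?_⟩
  simp only [convergenceDomain, mem_ofPred_eq, Complex.ofReal_re]
  refine ⟨by norm_num, by linarith, by linarith⟩

theorem convergenceDomain_subset_regularDomain :
    convergenceDomain D n ⊆ regularDomain D n := by
  rintro ⟨α, β⟩ ⟨h1, h2, h3⟩ k
  simp only at h1 h2 h3
  have hn : (0 : ℝ) ≤ n := Nat.cast_nonneg n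
  have hk : (0 : ℝ) ≤ k := Nat.cast_nonneg k
  refine ⟨fun h => ?_, fun h => ?_, fun h => ?_⟩
  all_goals
    have := congrArg Complex.re h
    simp [dualIndex] at this
    linarith

theorem countable_setOf_exists_affine_eq (a b : ℂ) (h : ∀ k : ℕ, a ≠ -(k : ℂ)) :
    {z : ℂ | ∃ k : ℕ, a + z * b = -(k : ℂ)}.Countable := by
  rw [ofPred_exists]
  refine countable_iUnion fun k => Set.Subsingleton.countable fun z hz w hw => ?_
  have hz : a + z * b = -(k : ℂ) := hz
  have hw : a + w * b = -(k : ℂ) := hw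
  rcases eq_or_ne b 0 with rfl | hb
  · exact absurd (by simpa using hz) (h k)
  · exact mul_right_cancel₀ hb (add_left_cancel (hz.trans hw.symm))

/-- On the complex line through two regular points, each polar hyperplane removes at most one
parameter. The complement of a countable set in `ℂ` is path connected, so the line joins the two
points inside the domain. -/
theorem isPreconnected_regularDomain : IsPreconnected (regularDomain D n) := by
  refine isPreconnected_of_forall_pair fun p hp q hq => ?_
  have c1 := countable_setOf_exists_affine_eq p.2 (q.2 - p.2) fun k => (hp k).1
  have c2 := countable_setOf_exists_affine_eq p.1 (q.1 - p.1) fun k => (hp k).2.1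
  have c3 := countable_setOf_exists_affine_eq (dualIndex D p.1 - p.2 + n)
    (-(q.1 - p.1) - (q.2 - p.2)) fun k => (hp k).2.2
  have hconn := ((c1.union (c2.union c3)).isPathConnected_compl_of_one_lt_rank
    (by rw [Complex.rank_real_complex]; norm_num)).isConnected.isPreconnected
  have hcont : Continuous fun z : ℂ => (p.1 + z * (q.1 - p.1), p.2 + z * (q.2 - p.2)) := by fun_prop
  have hmem : ∀ z : ℂ, (p.1 + z * (q.1 - p.1), p.2 + z * (q.2 - p.2)) ∈ regularDomain D n →
      z ∈ ({z : ℂ | ∃ k : ℕ, p.2 + z * (q.2 - p.2) = -(k : ℂ)} ∪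
        ({z : ℂ | ∃ k : ℕ, p.1 + z * (q.1 - p.1) = -(k : ℂ)} ∪
        {z : ℂ | ∃ k : ℕ, dualIndex D p.1 - p.2 + n + z * (-(q.1 - p.1) - (q.2 - p.2)) =
          -(k : ℂ)}))ᶜ := by
    rintro z hz (⟨k, hk⟩ | ⟨k, hk⟩ | ⟨k, hk⟩)
    · exact (hz k).1 hk
    · exact (hz k).2.1 hk
    · refine (hz k).2.2 (Eq.trans ?_ hk)
      simp only [dualIndex]
      ring
  refine ⟨_, ?_, (mem_image _ _ _).mpr ⟨0, hmem 0 (by simpa using hp), by simp⟩,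
    (mem_image _ _ _).mpr ⟨1, hmem 1 (by simpa using hq), by simp⟩,
    hconn.image _ hcont.continuousOn⟩
  rintro _ ⟨z, hz, rfl⟩ k
  simp only [mem_compl_iff, mem_union, mem_ofPred_eq, not_or, not_exists] at hz
  refine ⟨hz.1 k, hz.2.1 k, fun h => hz.2.2 k (Eq.trans ?_ h)⟩
  simp only [dualIndex]
  ring

theorem analyticAt_inv_Gamma_comp {f : ℂ × ℂ → ℂ} {p : ℂ × ℂ} (hf : AnalyticAt ℂ f p) :
    AnalyticAt ℂ (fun p => (Complex.Gamma (f p))⁻¹) p :=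
  (Complex.differentiable_one_div_Gamma.analyticAt (f p)).fun_comp hf

theorem analyticAt_Gamma_comp {f : ℂ × ℂ → ℂ} {p : ℂ × ℂ} (hf : AnalyticAt ℂ f p)
    (h : (Complex.Gamma (f p))⁻¹ ≠ 0) : AnalyticAt ℂ (fun p => Complex.Gamma (f p)) p := by
  have := (analyticAt_inv_Gamma_comp hf).inv h
  simpa only [Pi.inv_def, inv_inv] using this

theorem analyticAt_dualIndex_comp {f : ℂ × ℂ → ℂ} {p : ℂ × ℂ} (hf : AnalyticAt ℂ f p) :
    AnalyticAt ℂ (fun p => dualIndex D (f p)) p :=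
  analyticAt_const.fun_sub hf

theorem analyticAt_eigenvalue {p : ℂ × ℂ} (hp : p ∈ regularDomain D n) :
    AnalyticAt ℂ (fun p : ℂ × ℂ => eigenvalue D n p.1 p.2) p := by
  obtain ⟨h1, h2, h3⟩ := (mem_regularDomain_iff p).mp hp
  have a1 : AnalyticAt ℂ (fun p : ℂ × ℂ => p.1) p := analyticAt_fst
  have a2 : AnalyticAt ℂ (fun p : ℂ × ℂ => p.2) p := analyticAt_snd
  have d1 := analyticAt_dualIndex_comp (D := D) a1
  have d2 := analyticAt_dualIndex_comp (D := D) a2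
  have g1 := analyticAt_Gamma_comp a2 h1
  have g2 := analyticAt_Gamma_comp a1 h2
  have g3 := analyticAt_Gamma_comp ((d1.fun_sub a2).fun_add analyticAt_const) h3
  have g4 := analyticAt_inv_Gamma_comp d2
  have g5 := analyticAt_inv_Gamma_comp (d1.fun_add (analyticAt_const (v := (n : ℂ))))
  have g6 := analyticAt_inv_Gamma_comp (a1.fun_add a2)
  simp only [eigenvalue, div_eq_mul_inv, mul_inv]
  exact (analyticAt_const.mul (((analyticAt_const.mul g1).mul g2).mul g3)).mul ((g4.mul g5).mul g6)

theorem analyticAt_sqPow {x : E D} (hx : x ≠ 0) {f : ℂ × ℂ → ℂ} {p : ℂ × ℂ}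
    (hf : AnalyticAt ℂ f p) : AnalyticAt ℂ (fun p => sqPow x (f p)) p := by
  have h0 : ((‖x‖ ^ 2 : ℝ) : ℂ) ≠ 0 := by
    have := norm_pos_iff.mpr hx
    exact_mod_cast (by positivity : ‖x‖ ^ 2 ≠ 0)
  simp only [sqPow, Complex.cpow_def_of_ne_zero h0]
  exact (analyticAt_const.mul hf).cexp

theorem analyticAt_conformalTriangle (μ : Fin n → Fin D) {x₁ x₂ y : E D} (h₁₂ : x₁ ≠ x₂)
    (h₁ : x₁ ≠ y) (h₂ : x₂ ≠ y) (p : ℂ × ℂ) :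
    AnalyticAt ℂ (fun p : ℂ × ℂ => conformalTriangle p.1 p.2 y μ x₁ x₂) p := by
  have n1 : x₁ - x₂ ≠ 0 := sub_ne_zero.mpr h₁₂
  have n2 : y - x₁ ≠ 0 := sub_ne_zero.mpr h₁.symm
  have n3 : y - x₂ ≠ 0 := sub_ne_zero.mpr h₂.symm
  refine analyticAt_const.div (((analyticAt_sqPow n1 analyticAt_fst).mul
    (analyticAt_sqPow n2 (analyticAt_dualIndex_comp analyticAt_fst))).mul
    (analyticAt_sqPow n3 (analyticAt_dualIndex_comp (analyticAt_fst.fun_add analyticAt_snd))))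
    (mul_ne_zero (mul_ne_zero (sqPow_ne_zero n1 _) (sqPow_ne_zero n2 _)) (sqPow_ne_zero n3 _))

end Continuation

/-! ### Nonvanishing of the traceless power -/

section NonVanishing

variable {D n : ℕ}

theorem exists_orthogonal_norm_eq (hD : 2 ≤ D) (v : E D) :
    ∃ f : E D, inner ℝ v f = 0 ∧ ‖f‖ = ‖v‖ := by
  have hpos : 0 < Module.finrank ℝ (ℝ ∙ v)ᗮ := by
    have h1 := (ℝ ∙ v).finrank_add_finrank_orthogonal
    have h2 := finrank_span_le_card (R := ℝ) ({v} : Set (E D))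
    rw [finrank_euclideanSpace_fin] at h1
    rw [toFinset_singleton, Finset.card_singleton] at h2
    omega
  have : Nontrivial (ℝ ∙ v)ᗮ := Module.finrank_pos_iff.mp hpos
  obtain ⟨f, hf⟩ := exists_norm_eq ((ℝ ∙ v)ᗮ) (norm_nonneg v)
  exact ⟨f, (Submodule.mem_orthogonal_singleton_iff_inner_right).mp f.2, hf⟩

/-- The real part of the `n`-th tensor power of the complex vector `v + i f`. -/
def nullPow {D : ℕ} (n : ℕ) (v f : E D) : Tens D n :=
  WithLp.toLp 2 fun μ => (∏ i, ((v (μ i) : ℂ) + f (μ i) * Complex.I)).re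

/-- The vector `v + i f` is null for the bilinear square, so every trace of its tensor power
contains a zero factor. -/
theorem nullPow_mem {v f : E D} (hvf : inner ℝ v f = 0) (hf : ‖f‖ = ‖v‖) :
    nullPow n v f ∈ symTraceless D n := by
  refine ⟨fun σ ρ => ?_, fun i j hij ρ => ?_⟩
  · simp only [nullPow, Function.comp_apply]
    rw [Equiv.prod_comp σ fun i => (v (ρ i) : ℂ) + f (ρ i) * Complex.I]
  · have hnull : ∑ a, ((v a : ℂ) + f a * Complex.I) * ((v a : ℂ) + f a * Complex.I) = 0 := by
      have h1 : ∀ a, ((v a : ℂ) + f a * Complex.I) * ((v a : ℂ) + f a * Complex.I) =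
          ((v a ^ 2 - f a ^ 2 : ℝ) : ℂ) + ((2 * (v a * f a) : ℝ) : ℂ) * Complex.I := fun a => by
        push_cast
        linear_combination ((f a : ℂ) ^ 2) * Complex.I_sq
      simp only [h1]
      rw [Finset.sum_add_distrib, ← Finset.sum_mul, ← Complex.ofReal_sum, ← Complex.ofReal_sum,
        Finset.sum_sub_distrib, ← Finset.mul_sum, ← EuclideanSpace.real_norm_sq_eq,
        ← EuclideanSpace.real_norm_sq_eq, hf]
      have h2 : ∑ a, v a * f a = 0 := by
        rw [← hvf, PiLp.inner_apply]
        exact Finset.sum_congr rfl fun a _ => by simp [mul_comm]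
      simp [h2]
    have hsplit : ∀ a, ∏ k, ((v (Function.update (Function.update ρ i a) j a k) : ℂ) +
        f (Function.update (Function.update ρ i a) j a k) * Complex.I) =
        ((v a : ℂ) + f a * Complex.I) * ((v a : ℂ) + f a * Complex.I) *
          ∏ k ∈ (Finset.univ.erase j).erase i, ((v (ρ k) : ℂ) + f (ρ k) * Complex.I) := fun a => by
      rw [← Finset.mul_prod_erase _ _ (Finset.mem_univ j),
        ← Finset.mul_prod_erase _ _ (Finset.mem_erase.mpr ⟨hij, Finset.mem_univ i⟩), ← mul_assoc]
      congr 1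
      · simp [Function.update_of_ne hij]
      · refine Finset.prod_congr rfl fun k hk => ?_
        rw [Function.update_of_ne (Finset.ne_of_mem_erase (Finset.mem_of_mem_erase hk)),
          Function.update_of_ne (Finset.ne_of_mem_erase hk)]
    simp only [nullPow, hsplit]
    rw [← Complex.re_sum, ← Finset.sum_mul, hnull, zero_mul, Complex.zero_re]

theorem inner_nullPow {v f : E D} (hvf : inner ℝ v f = 0) :
    inner ℝ (nullPow n v f) (tensorPow n v) = (‖v‖ ^ 2) ^ n := by
  have h1 : ∑ a, ((v a : ℂ) + f a * Complex.I) * v a = ((‖v‖ ^ 2 : ℝ) : ℂ) := by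
    have h2 : ∑ a, f a * v a = 0 := by
      rw [← hvf, PiLp.inner_apply]
      exact Finset.sum_congr rfl fun a _ => by simp
    have h3 : ∀ a, ((v a : ℂ) + f a * Complex.I) * v a =
        ((v a ^ 2 : ℝ) : ℂ) + ((f a * v a : ℝ) : ℂ) * Complex.I := fun a => by
      push_cast
      ring
    simp only [h3]
    rw [Finset.sum_add_distrib, ← Finset.sum_mul, ← Complex.ofReal_sum, ← Complex.ofReal_sum, h2,
      ← EuclideanSpace.real_norm_sq_eq]
    simp
  have h4 : (∑ ρ : Fin n → Fin D, ∏ i, ((v (ρ i) : ℂ) + f (ρ i) * Complex.I) * v (ρ i)) =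
      (((‖v‖ ^ 2) ^ n : ℝ) : ℂ) := by
    rw [Complex.ofReal_pow, ← h1, Fintype.sum_pow]
  rw [PiLp.inner_apply, ← Complex.ofReal_re ((‖v‖ ^ 2) ^ n), ← h4, Complex.re_sum]
  refine Finset.sum_congr rfl fun ρ _ => ?_
  rw [Finset.prod_mul_distrib, ← Complex.ofReal_prod, Complex.re_mul_ofReal]
  simp [nullPow, tensorPow, mul_comm]

/-- The projector fixes `nullPow n v f`, so pairing it with the traceless power equals pairing it
with `v^{⊗n}`, namely `‖v‖^{2n} > 0`. A suitable `f` orthogonal to `v` exists because `D ≥ 2`. -/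
theorem exists_tracelessPow_ne_zero (hD : 2 ≤ D) {v : E D} (hv : v ≠ 0) :
    ∃ μ : Fin n → Fin D, tracelessPow n v μ ≠ 0 := by
  obtain ⟨f, hvf, hf⟩ := exists_orthogonal_norm_eq hD v
  by_contra! h
  have h0 : tracelessPow n v = 0 := PiLp.ext h
  have h1 := Submodule.inner_starProjection_left_eq_right (symTraceless D n)
    (nullPow n v f) (tensorPow n v)
  rw [Submodule.starProjection_eq_self_iff.mpr (nullPow_mem hvf hf), inner_nullPow hvf] at h1
  change _ = inner ℝ _ (tracelessPow n v) at h1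
  rw [h0, inner_zero_right] at h1
  have := norm_pos_iff.mpr hv
  have : 0 < (‖v‖ ^ 2) ^ n := by positivity
  linarith

end NonVanishing

/-! ### The main theorem -/

theorem proposition2 (D n : ℕ) (hD : 1 ≤ D) (x₁ x₂ y : E D)
    (h₁₂ : x₁ ≠ x₂) (h₁ : x₁ ≠ y) (h₂ : x₂ ≠ y) :
    -- where the integral converges, the conformal triangle satisfies the eigenvalue equation
    (∀ α β : ℂ, (α, β) ∈ convergenceDomain D n → ∀ μ : Fin n → Fin D,
      GraphBuildingConverges β (conformalTriangle α β y μ) x₁ x₂ ∧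
      graphBuilding β (conformalTriangle α β y μ) x₁ x₂ =
        eigenvalue D n α β * conformalTriangle α β y μ x₁ x₂) ∧
    -- for all other parameters, the operator acts by analytic continuation in `(α, β)`
    (∀ μ : Fin n → Fin D,
      (∃ G : ℂ × ℂ → ℂ, IsAnalyticContinuation
        (fun p => graphBuilding p.2 (conformalTriangle p.1 p.2 y μ) x₁ x₂)
        (convergenceDomain D n) (regularDomain D n) G) ∧
      ∀ G : ℂ × ℂ → ℂ, IsAnalyticContinuation
          (fun p => graphBuilding p.2 (conformalTriangle p.1 p.2 y μ) x₁ x₂)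
          (convergenceDomain D n) (regularDomain D n) G →
        ∀ α β : ℂ, (α, β) ∈ regularDomain D n →
          G (α, β) = eigenvalue D n α β * conformalTriangle α β y μ x₁ x₂) ∧
    -- the conformal triangle does not vanish
    (2 ≤ D → ∀ α β : ℂ, ∃ μ : Fin n → Fin D, conformalTriangle α β y μ x₁ x₂ ≠ 0) := by
  have : NeZero D := ⟨by omega⟩
  have heig : ∀ α β : ℂ, (α, β) ∈ convergenceDomain D n → ∀ μ : Fin n → Fin D, _ :=
    fun α β h μ => graphBuilding_conformalTriangle h μ h₁₂ h₁ h₂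
  refine ⟨heig, fun μ => ?_, fun hD2 α β => ?_⟩
  · have han : AnalyticOnNhd ℂ (fun p : ℂ × ℂ =>
        eigenvalue D n p.1 p.2 * conformalTriangle p.1 p.2 y μ x₁ x₂) (regularDomain D n) :=
      fun p hp => (analyticAt_eigenvalue hp).mul (analyticAt_conformalTriangle μ h₁₂ h₁ h₂ p)
    obtain ⟨p₀, hp₀⟩ := convergenceDomain_nonempty (n := n) hD
    have hp₀' := convergenceDomain_subset_regularDomain hp₀
    constructor
    · exact ⟨_, isOpen_convergenceDomain, ⟨p₀, hp₀⟩, convergenceDomain_subset_regularDomain,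
        isOpen_regularDomain, ⟨⟨p₀, hp₀'⟩, isPreconnected_regularDomain⟩, han,
        fun p hp => (heig p.1 p.2 hp μ).2.symm⟩
    · rintro G ⟨-, -, -, -, -, hG, hGF⟩ α β hαβ
      refine hG.eqOn_of_preconnected_of_eventuallyEq han isPreconnected_regularDomain hp₀' ?_ hαβ
      filter_upwards [isOpen_convergenceDomain.mem_nhds hp₀] with p hp
      exact (hGF hp).trans (heig p.1 p.2 hp μ).2
  · have hv : inversion (y - x₁) - inversion (y - x₂) ≠ 0 := by
      rw [sub_ne_zero]
      exact fun h => h₁₂ (sub_right_injective (inversion_injective h))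
    obtain ⟨μ, hμ⟩ := exists_tracelessPow_ne_zero (n := n) hD2 hv
    refine ⟨μ, div_ne_zero (by exact_mod_cast hμ) (mul_ne_zero (mul_ne_zero ?_ ?_) ?_)⟩
    · exact sqPow_ne_zero (sub_ne_zero.mpr h₁₂) _
    · exact sqPow_ne_zero (sub_ne_zero.mpr h₁.symm) _
    · exact sqPow_ne_zero (sub_ne_zero.mpr h₂.symm) _

end
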